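/- Let $\Gamma$ be a finite connected simplicial graph of girth at least $6$ (acyclic graphs, whose girth is $\infty$, are allowed), and let $N$ be the maximum degree of $\Gamma$. Let $$A(\Gamma)=\langle v\in V(\Gamma)\mid [u,v]=1 \text{ for all } \{u,v\}\in E(\Gamma)\rangle$$ be the right-angled Artin group of $\Gamma$. Its extension graph $\Gamma^e$ is the simplicial graph whose vertices are the elements $v^g=g^{-1}vg$ of $A(\Gamma)$ with $v\in V(\Gamma)$ and $g\in A(\Gamma)$, two distinct vertices being joined by an edge exactly when they commute in $A(\Gamma)$. The group $A(\Gamma)$ acts on $\Gamma^e$ from the right by $x\mapsto x^g=g^{-1}xg$. With $d$ the edge metric of $\Gamma^e$, the asymptotic translation length of $g\in A(\Gamma)$ is $\tau(g)=\lim_{n\to\infty} d(x,x^{g^n})/n$, which exists and does not depend on the vertex $x$ of $\Gamma^e$; the element $g$ is called loxodromic if $\tau(g)>0$. A geodesic of $\Gamma^e$ here is a bi-infinite one, that is, the image of a map $\gamma:\mathbb{Z}\to V(\Gamma^e)$ with $d(\gamma(i),\gamma(j))=|i-j|$ for all $i,j\in\mathbb{Z}$. Then every loxodromic $g\in A(\Gamma)$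 cyclically permutes at most $N$ pairwise disjoint geodesics of $\Gamma^e$: there are an integer $m$ with $1\le m\le N$ and pairwise disjoint geodesics $L_i$ $(i\in\mathbb{Z}/m\mathbb{Z})$ of $\Gamma^e$ such that $L_i^g=L_{i+1}$ for all $i$. Moreover, $\tau(g)$ is a rational number whose denominator in lowest terms is at most $N$. -/

import Mathlib

open Filter Topology
open scoped commutatorElement

namespace RAAG

/-- The right-angled Artin group `A(Γ)`: one generator for each vertex of `Γ`, and one relation
`[u, v] = 1` for each edge `{u, v}` of `Γ`. -/
abbrev ArtinGroup {V : Type*} (Γ : SimpleGraph V) : Type _ :=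
  PresentedGroup
    {r : FreeGroup V | ∃ u v : V, Γ.Adj u v ∧ r = ⁅FreeGroup.of u, FreeGroup.of v⁆}

/-- The vertex `v` of `Γ`, as a generator of `A(Γ)`. -/
def gen {V : Type*} (Γ : SimpleGraph V) (v : V) : ArtinGroup Γ :=
  PresentedGroup.of v

/-- The vertices of the extension graph `Γ^e`: the elements `v ^ g = g⁻¹ v g` of `A(Γ)`, for
`v` a vertex of `Γ` and `g ∈ A(Γ)`. -/
abbrev ExtVertex {V : Type*} (Γ : SimpleGraph V) : Type _ :=
  {x : ArtinGroup Γ // ∃ (v : V) (g : ArtinGroup Γ), x = g⁻¹ * gen Γ v * g}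

/-- The extension graph `Γ^e`: two distinct conjugates of generators are joined by an edge
when they commute in `A(Γ)`. -/
def extGraph {V : Type*} (Γ : SimpleGraph V) : SimpleGraph (ExtVertex Γ) where
  Adj x y := x ≠ y ∧ ⁅x.1, y.1⁆ = 1
  symm := ⟨fun x y h => ⟨h.1.symm, by
    rw [commutatorElement_eq_one_iff_commute] at *
    exact h.2.symm⟩⟩
  loopless := ⟨fun _ h => h.1 rfl⟩

/-- The (right) action of `A(Γ)` on `Γ^e`: the element `g` acts by the graph automorphism
`x ↦ x ^ g = g⁻¹ x g`. -/
def act {V : Type*} (Γ : SimpleGraph V) (g : ArtinGroup Γ) : extGraph Γ ≃g extGraph Γ where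
  toFun x := ⟨g⁻¹ * x.1 * g, by
    obtain ⟨v, h, hx⟩ := x.2
    exact ⟨v, h * g, by rw [hx]; group⟩⟩
  invFun x := ⟨g * x.1 * g⁻¹, by
    obtain ⟨v, h, hx⟩ := x.2
    exact ⟨v, h * g⁻¹, by rw [hx]; group⟩⟩
  left_inv x := by ext; simp [mul_assoc]
  right_inv x := by ext; simp [mul_assoc]
  map_rel_iff' := by
    intro x y
    have hc : ⁅g⁻¹ * x.1 * g, g⁻¹ * y.1 * g⁆ = g⁻¹ * ⁅x.1, y.1⁆ * g := by
      simp only [commutatorElement_def]; group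
    have h1 : ⁅g⁻¹ * x.1 * g, g⁻¹ * y.1 * g⁆ = 1 ↔ ⁅x.1, y.1⁆ = 1 := by
      rw [hc]
      constructor
      · intro h
        have h2 : ⁅x.1, y.1⁆ = g * (g⁻¹ * ⁅x.1, y.1⁆ * g) * g⁻¹ := by group
        rw [h2, h]; group
      · intro h; rw [h]; group
    have h3 : (g⁻¹ * x.1 * g = g⁻¹ * y.1 * g) ↔ x = y := by
      simp [Subtype.ext_iff]
    simp only [extGraph, Equiv.coe_fn_mk, ne_eq, Subtype.mk.injEq, h1, h3]

/-- `τ` is the asymptotic translation length of `g ∈ A(Γ)` on `Γ^e` with the edge metric: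
`d(x, x ^ (g ^ n)) / n → τ` for every vertex `x` of `Γ^e`. -/
def IsTranslationLength {V : Type*} (Γ : SimpleGraph V) (g : ArtinGroup Γ) (τ : ℝ) : Prop :=
  ∀ x : ExtVertex Γ,
    Tendsto (fun n : ℕ => ((extGraph Γ).dist x (act Γ (g ^ n) x) : ℝ) / n) atTop (𝓝 τ)

/-- `g ∈ A(Γ)` is loxodromic: its asymptotic translation length on `Γ^e` is positive. -/
def IsLoxodromic {V : Type*} (Γ : SimpleGraph V) (g : ArtinGroup Γ) : Prop :=
  ∃ τ : ℝ, 0 < τ ∧ IsTranslationLength Γ g τ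

/-- `L` is (the vertex set of) a bi-infinite geodesic of the graph `G`, that is, the image of an
isometric embedding of the line `ℤ`. -/
def IsGeodesicLine {W : Type*} (G : SimpleGraph W) (L : Set W) : Prop :=
  ∃ γ : ℤ → W, (∀ i j : ℤ, G.dist (γ i) (γ j) = (i - j).natAbs) ∧ L = Set.range γ

/-- For `m ≥ 1`: the automorphism `φ` of `G` cyclically permutes `m` pairwise disjoint geodesics:
there are pairwise disjoint geodesics `L i`, indexed by `i` modulo `m`, with
`φ (L i) = L (i + 1)`. -/
def CyclicallyPermutes {W : Type*} (G : SimpleGraph W) (φ : G ≃g G) (m : ℕ) : Prop :=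
  ∃ L : ZMod m → Set W,
    (∀ i, IsGeodesicLine G (L i)) ∧
    (∀ i j, i ≠ j → Disjoint (L i) (L j)) ∧
    ∀ i, φ '' L i = L (i + 1)

/-! The extension graph of a connected graph is connected, and asymptotic translation lengths
exist and do not depend on the base point. -/

theorem gen_commute {V : Type*} {Γ : SimpleGraph V} {u v : V} (h : Γ.Adj u v) :
    ⁅gen Γ u, gen Γ v⁆ = 1 := by
  have := PresentedGroup.one_of_mem
    (rels := {r : FreeGroup V | ∃ u v : V, Γ.Adj u v ∧ r = ⁅FreeGroup.of u, FreeGroup.of v⁆})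
    (x := ⁅FreeGroup.of u, FreeGroup.of v⁆) ⟨u, v, h, rfl⟩
  rw [map_commutatorElement] at this
  exact this

theorem act_mul {V : Type*} (Γ : SimpleGraph V) (g h : ArtinGroup Γ) (x : ExtVertex Γ) :
    act Γ (g * h) x = act Γ h (act Γ g x) := by
  apply Subtype.ext
  change (g * h)⁻¹ * x.1 * (g * h) = h⁻¹ * (g⁻¹ * x.1 * g) * h
  group

/-- The vertex `v` of `Γ`, as a vertex of `Γ^e`. -/
def incl {V : Type*} (Γ : SimpleGraph V) (v : V) : ExtVertex Γ :=
  ⟨gen Γ v, v, 1, by simp⟩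

theorem reachable_act {V : Type*} {Γ : SimpleGraph V} {x y : ExtVertex Γ} (g : ArtinGroup Γ)
    (h : (extGraph Γ).Reachable x y) : (extGraph Γ).Reachable (act Γ g x) (act Γ g y) :=
  h.map (act Γ g).toHom

theorem extGraph_connected {V : Type*} {Γ : SimpleGraph V} (hΓ : Γ.Connected) :
    (extGraph Γ).Connected := by
  have hadj : ∀ u v : V, Γ.Adj u v → (extGraph Γ).Reachable (incl Γ u) (incl Γ v) := by
    intro u v h
    by_cases he : incl Γ u = incl Γ v
    · rw [he]
    · exact SimpleGraph.Adj.reachable ⟨he, gen_commute h⟩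
  have hV : ∀ u v : V, (extGraph Γ).Reachable (incl Γ u) (incl Γ v) := by
    intro u v
    obtain ⟨w⟩ := hΓ.preconnected u v
    induction w with
    | nil => exact SimpleGraph.Reachable.refl _
    | cons h _ ih => exact (hadj _ _ h).trans ih
  have hself : ∀ v : V, act Γ (gen Γ v) (incl Γ v) = incl Γ v := by
    intro v
    apply Subtype.ext
    change (gen Γ v)⁻¹ * gen Γ v * gen Γ v = gen Γ v
    group
  have hgen : ∀ u v : V, (extGraph Γ).Reachable (incl Γ u) (act Γ (gen Γ v) (incl Γ u)) := by
    intro u v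
    have h1 := reachable_act (gen Γ v) (hV v u)
    rw [hself] at h1
    exact (hV u v).trans h1
  -- the set of all `g` that move a base point within its component
  have hall : ∀ (u : V) (g : ArtinGroup Γ),
      (extGraph Γ).Reachable (incl Γ u) (act Γ g (incl Γ u)) := by
    intro u g
    let H : Subgroup (ArtinGroup Γ) :=
      { carrier := {g | (extGraph Γ).Reachable (incl Γ u) (act Γ g (incl Γ u))}
        mul_mem' := by
          intro a b ha hb
          change (extGraph Γ).Reachable _ _
          rw [act_mul]
          exact SimpleGraph.Reachable.trans hb (reachable_act b ha)
        one_mem' := by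
          change (extGraph Γ).Reachable _ _
          have : act Γ 1 (incl Γ u) = incl Γ u := by
            apply Subtype.ext
            change (1 : ArtinGroup Γ)⁻¹ * gen Γ u * 1 = gen Γ u
            group
          rw [this]
        inv_mem' := by
          intro a ha
          change (extGraph Γ).Reachable _ _
          have h1 := reachable_act a⁻¹ ha
          rw [← act_mul, mul_inv_cancel] at h1
          have : act Γ 1 (incl Γ u) = incl Γ u := by
            apply Subtype.ext
            change (1 : ArtinGroup Γ)⁻¹ * gen Γ u * 1 = gen Γ u
            group
          rw [this] at h1
          exact h1.symm }
    exact PresentedGroup.generated_by _ H (fun v => hgen u v) g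
  obtain ⟨u₀⟩ := hΓ.nonempty
  have hbase : ∀ x : ExtVertex Γ, (extGraph Γ).Reachable (incl Γ u₀) x := by
    rintro ⟨_, v, g, rfl⟩
    exact (hV u₀ v).trans (hall v g)
  exact { preconnected := fun x y => (hbase x).symm.trans (hbase y)
          nonempty := ⟨incl Γ u₀⟩ }

theorem dist_act {V : Type*} {Γ : SimpleGraph V} (hΓ : Γ.Connected) (g : ArtinGroup Γ)
    (x y : ExtVertex Γ) :
    (extGraph Γ).dist (act Γ g x) (act Γ g y) = (extGraph Γ).dist x y := by
  have key : ∀ (φ : extGraph Γ ≃g extGraph Γ) (a b : ExtVertex Γ),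
      (extGraph Γ).dist (φ a) (φ b) ≤ (extGraph Γ).dist a b := by
    intro φ a b
    obtain ⟨p, hp⟩ := (extGraph_connected hΓ).exists_walk_length_eq_dist a b
    rw [← hp, ← SimpleGraph.Walk.length_map φ.toHom p]
    exact SimpleGraph.dist_le _
  refine le_antisymm (key _ _ _) ?_
  simpa using key (act Γ g).symm (act Γ g x) (act Γ g y)

theorem exists_translationLength {V : Type*} {Γ : SimpleGraph V} (hΓ : Γ.Connected)
    (g : ArtinGroup Γ) : ∃! τ : ℝ, IsTranslationLength Γ g τ := by
  have hc := extGraph_connected hΓ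
  obtain ⟨x₀⟩ := hc.nonempty
  let d : ExtVertex Γ → ℕ → ℝ := fun x n => ((extGraph Γ).dist x (act Γ (g ^ n) x) : ℝ)
  have hsub : Subadditive (d x₀) := by
    intro m n
    have h1 := hc.dist_triangle (u := x₀) (v := act Γ (g ^ n) x₀) (w := act Γ (g ^ (m + n)) x₀)
    rw [pow_add, act_mul, dist_act hΓ] at h1
    simp only [d]
    rw [pow_add, act_mul]
    have h2 : ((extGraph Γ).dist x₀ (act Γ (g ^ n) (act Γ (g ^ m) x₀)) : ℝ) ≤
        (extGraph Γ).dist x₀ (act Γ (g ^ n) x₀) + (extGraph Γ).dist x₀ (act Γ (g ^ m) x₀) := by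
      exact_mod_cast h1
    linarith
  have hbdd : BddBelow (Set.range fun n => d x₀ n / n) := by
    refine ⟨0, ?_⟩
    rintro _ ⟨n, rfl⟩
    positivity
  have hlim := hsub.tendsto_lim hbdd
  refine ⟨hsub.lim, ?_, fun τ hτ => tendsto_nhds_unique (hτ x₀) hlim⟩
  intro x
  have hcmp : ∀ a b : ExtVertex Γ, ∀ n, d a n ≤ d b n + 2 * (extGraph Γ).dist a b := by
    intro a b n
    have h1 := hc.dist_triangle (u := a) (v := b) (w := act Γ (g ^ n) a)
    have h2 := hc.dist_triangle (u := b) (v := act Γ (g ^ n) b) (w := act Γ (g ^ n) a)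
    rw [dist_act hΓ, SimpleGraph.dist_comm (u := b) (v := a)] at h2
    have h3 : (extGraph Γ).dist a (act Γ (g ^ n) a) ≤
        (extGraph Γ).dist b (act Γ (g ^ n) b) + 2 * (extGraph Γ).dist a b := by omega
    simp only [d]
    exact_mod_cast h3
  have hzero : Tendsto (fun n : ℕ => (2 * ((extGraph Γ).dist x x₀ : ℝ)) / n) atTop (𝓝 0) :=
    tendsto_const_div_atTop_nhds_zero_nat _
  have hlo := hlim.sub hzero
  have hhi := hlim.add hzero
  rw [sub_zero] at hlo
  rw [add_zero] at hhi
  refine tendsto_of_tendsto_of_tendsto_of_le_of_le hlo hhi ?_ ?_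
  · intro n
    have h := hcmp x₀ x n
    rw [SimpleGraph.dist_comm] at h
    change d x₀ n / n - _ / n ≤ d x n / n
    rw [← sub_div]
    gcongr
    linarith
  · intro n
    have h := hcmp x x₀ n
    change d x n / n ≤ d x₀ n / n + _ / n
    rw [← add_div]
    gcongr

end RAAG

/-! View `A(Γ)` as its Cayley graph under left multiplication by letters. The edges parallel to `x →
vx`, those from `lx` to `vlx` with `l` in the link subgroup of `v`, form a wall; the vertex `v^x` of
`Γ^e` depends only on this wall and serves as its center. Each wall bounds a half-space
(`exists_side`), and a path of `Γ^e` whose ends have representatives on opposite sides of a wall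
must meet the star of its center. A shortest word among those representing conjugates of `g` gives a
`g`-invariant axis, which crosses each wall at most once (`Axis.h_mem_H_iff`).

The key is a set `S` of at most `N` vertices of `Γ^e` such that, from any point of `S` to a far
translate of a fixed vertex `e`, some geodesic passes through the `g`-translate of `S` (`Transit`).
If two consecutive letters of the axis are adjacent in `Γ`, then `S` consists of the two adjacent
centers: `Γ^e` has no triangles, squares or pentagons, so a geodesic meeting both stars can be
rerouted through a center. If no two consecutive letters are adjacent, paths of `Γ^e` project to the
axis without getting longer, and `S` is a copy of the link of one letter.

Iterating `Transit` turns geodesics into walks on the finite set `S`, where a step from `p` to `q`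
costs `d(p, q^g)`. Minimum mean cost is attained on a loop of length at most `|S|`, so some `p` and
`m ≤ N` satisfy `d(p, p^(g^m)) = mτ(g)`. This makes `τ(g)` rational with denominator dividing `m`,
and translates of a segment from `p` to `p^(g^m)` form a geodesic line. When `m` is least, the lines
obtained by applying `1, g, …, g^(m-1)` are pairwise disjoint. -/

namespace RAAG

/-! ### Parabolic subgroups, centralizers and edges of the extension graph -/

section Algebra

variable {V : Type*} {Γ : SimpleGraph V}

/-- The letters `v` and `v⁻¹` as elements of the group. -/
def ltr (Γ : SimpleGraph V) (t : V × Bool) : ArtinGroup Γ :=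
  if t.2 then gen Γ t.1 else (gen Γ t.1)⁻¹

/-- The inverse letter. -/
def inv (t : V × Bool) : V × Bool := (t.1, !t.2)

theorem inv_inv (t : V × Bool) : inv (inv t) = t := by simp [inv]

theorem ltr_inv (t : V × Bool) : ltr Γ (inv t) = (ltr Γ t)⁻¹ := by
  rcases t with ⟨v, _ | _⟩ <;> simp [ltr, inv]

/-- The standard parabolic subgroup generated by a set of vertices. -/
def parabolic (Γ : SimpleGraph V) (T : Set V) : Subgroup (ArtinGroup Γ) :=
  Subgroup.closure (gen Γ '' T)

/-- The subgroup generated by the link of a vertex. -/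
abbrev lk (Γ : SimpleGraph V) (v : V) : Subgroup (ArtinGroup Γ) :=
  parabolic Γ (Γ.neighborSet v)

theorem gen_mem_parabolic {T : Set V} {v : V} (h : v ∈ T) : gen Γ v ∈ parabolic Γ T :=
  Subgroup.subset_closure ⟨v, h, rfl⟩

theorem ltr_mem_parabolic {T : Set V} {t : V × Bool} (h : t.1 ∈ T) : ltr Γ t ∈ parabolic Γ T := by
  rcases t with ⟨v, _ | _⟩
  · exact inv_mem (gen_mem_parabolic h)
  · exact gen_mem_parabolic h

theorem parabolic_mono {S T : Set V} (h : S ⊆ T) : parabolic Γ S ≤ parabolic Γ T :=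
  Subgroup.closure_mono (Set.image_mono h)

theorem parabolic_induction {T : Set V} {Q : ArtinGroup Γ → Prop} {x : ArtinGroup Γ} (hx : Q x)
    (step : ∀ t : V × Bool, t.1 ∈ T → ∀ y, Q y → Q (ltr Γ t * y)) {c : ArtinGroup Γ}
    (hc : c ∈ parabolic Γ T) : Q (c * x) := by
  induction hc using Subgroup.closure_induction_left with
  | one => simpa using hx
  | mul_left a ha y hy ih =>
    obtain ⟨v, hv, rfl⟩ := ha
    rw [mul_assoc]
    exact step (v, true) hv _ ih
  | inv_mul_cancel a ha y hy ih =>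
    obtain ⟨v, hv, rfl⟩ := ha
    rw [mul_assoc]
    exact step (v, false) hv _ ih

theorem parabolic_univ : parabolic Γ Set.univ = ⊤ := by
  rw [parabolic, Set.image_univ]
  exact PresentedGroup.closure_range_of _

theorem ltr_induction {Q : ArtinGroup Γ → Prop} {x : ArtinGroup Γ} (hx : Q x)
    (step : ∀ t y, Q y → Q (ltr Γ t * y)) (y : ArtinGroup Γ) : Q y := by
  have := parabolic_induction (T := Set.univ) hx (fun t _ => step t) (c := y * x⁻¹)
    (by rw [parabolic_univ]; trivial)
  simpa using this

theorem ltr_induction_gen {Q : ArtinGroup Γ → Prop} {x : ArtinGroup Γ} (hx : Q x)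
    (step : ∀ v y, Q y ↔ Q (gen Γ v * y)) (y : ArtinGroup Γ) : Q y := by
  refine ltr_induction hx ?_ y
  rintro ⟨v, _ | _⟩ y hy
  · refine (step v _).2 ?_
    simpa [ltr] using hy
  · exact (step v _).1 hy

theorem commute_gen {u v : V} (h : Γ.Adj u v) : Commute (gen Γ u) (gen Γ v) :=
  commutatorElement_eq_one_iff_commute.1 (gen_commute h)

/-- Homomorphisms out of the group, given on generators. -/
def liftHom {G : Type*} [Group G] (f : V → G) (hf : ∀ u v, Γ.Adj u v → Commute (f u) (f v)) :
    ArtinGroup Γ →* G :=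
  PresentedGroup.toGroup (f := f) (by
    rintro r ⟨u, v, h, rfl⟩
    rw [map_commutatorElement, FreeGroup.lift_apply_of, FreeGroup.lift_apply_of,
      commutatorElement_eq_one_iff_commute]
    exact hf u v h)

theorem liftHom_gen {G : Type*} [Group G] (f : V → G)
    (hf : ∀ u v, Γ.Adj u v → Commute (f u) (f v)) (v : V) : liftHom f hf (gen Γ v) = f v :=
  PresentedGroup.toGroup.of _

/-- Integration of a compatible family of weights along left multiplication by generators. -/
theorem exists_cocycle (w : V → ArtinGroup Γ → ℤ)
    (hw : ∀ u v x, Γ.Adj u v → w v x + w u (gen Γ v * x) = w u x + w v (gen Γ u * x)) :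
    ∃ f : ArtinGroup Γ → ℤ, f 1 = 0 ∧ ∀ v x, f (gen Γ v * x) = f x + w v x := by
  -- Let `v` act on `A(Γ) × ℤ`, the second coordinate accumulating the weight. Hypothesis `hw` says
  -- exactly that adjacent generators act by commuting permutations, so the whole group acts and `f`
  -- is read off the orbit of `(1, 0)`.
  let σ : V → Equiv.Perm (ArtinGroup Γ × ℤ) := fun v =>
    { toFun := fun p => (gen Γ v * p.1, p.2 + w v p.1)
      invFun := fun p => ((gen Γ v)⁻¹ * p.1, p.2 - w v ((gen Γ v)⁻¹ * p.1))
      left_inv := fun p => by simp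
      right_inv := fun p => by simp }
  let φ : ArtinGroup Γ →* Equiv.Perm (ArtinGroup Γ × ℤ) := liftHom σ (by
    intro u v h
    ext p
    · change gen Γ u * (gen Γ v * p.1) = gen Γ v * (gen Γ u * p.1)
      rw [← mul_assoc, (commute_gen h).eq, mul_assoc]
    · change p.2 + w v p.1 + w u (gen Γ v * p.1) = p.2 + w u p.1 + w v (gen Γ u * p.1)
      have := hw u v p.1 h
      omega)
  have hφ : ∀ v, φ (gen Γ v) = σ v := fun v => liftHom_gen _ _ v
  have h1 : ∀ x, (φ x (1, 0)).1 = x := by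
    refine ltr_induction_gen (x := 1) (by simp) ?_
    intro v y
    rw [map_mul, hφ]
    change _ ↔ gen Γ v * (φ y (1, 0)).1 = gen Γ v * y
    simp
  refine ⟨fun x => (φ x (1, 0)).2, by simp, fun v x => ?_⟩
  change (φ (gen Γ v * x) (1, 0)).2 = _
  rw [map_mul, hφ]
  change (φ x (1, 0)).2 + w v (φ x (1, 0)).1 = _
  rw [h1]

open Classical in
/-- The retraction onto a standard parabolic subgroup, killing the other generators. -/
noncomputable def retr (Γ : SimpleGraph V) (T : Set V) : ArtinGroup Γ →* ArtinGroup Γ :=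
  liftHom (fun v => if v ∈ T then gen Γ v else 1) (by
    intro u v h
    split_ifs
    · exact commute_gen h
    all_goals simp)

theorem retr_gen_mem {T : Set V} {v : V} (h : v ∈ T) : retr Γ T (gen Γ v) = gen Γ v := by
  rw [retr, liftHom_gen, if_pos h]

theorem retr_gen_not_mem {T : Set V} {v : V} (h : v ∉ T) : retr Γ T (gen Γ v) = 1 := by
  rw [retr, liftHom_gen, if_neg h]

theorem retr_eq_self {T : Set V} {x : ArtinGroup Γ} (hx : x ∈ parabolic Γ T) :
    retr Γ T x = x := by
  have h : parabolic Γ T ≤ (retr Γ T).eqLocus (MonoidHom.id _) := by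
    rw [parabolic, Subgroup.closure_le]
    rintro _ ⟨v, hv, rfl⟩
    exact retr_gen_mem hv
  exact h hx

theorem retr_mem {S T : Set V} {x : ArtinGroup Γ} (hx : x ∈ parabolic Γ S) :
    retr Γ T x ∈ parabolic Γ (S ∩ T) := by
  have h : parabolic Γ S ≤ (parabolic Γ (S ∩ T)).comap (retr Γ T) := by
    rw [parabolic, Subgroup.closure_le]
    rintro _ ⟨v, hv, rfl⟩
    rw [SetLike.mem_coe, Subgroup.mem_comap]
    by_cases h : v ∈ T
    · rw [retr_gen_mem h]
      exact gen_mem_parabolic ⟨hv, h⟩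
    · rw [retr_gen_not_mem h]
      exact one_mem _
  exact h hx

theorem retr_mem' {T : Set V} (x : ArtinGroup Γ) : retr Γ T x ∈ parabolic Γ T := by
  have := retr_mem (T := T) (x := x) (S := Set.univ) (by rw [parabolic_univ]; trivial)
  simpa using this

theorem parabolic_empty {T : Set V} (hT : T = ∅) {x : ArtinGroup Γ} (hx : x ∈ parabolic Γ T) :
    x = 1 := by
  subst hT
  simpa [parabolic] using hx

/-- The star of a vertex. -/
def star (Γ : SimpleGraph V) (v : V) : Set V := insert v (Γ.neighborSet v)

theorem commute_of_mem_parabolic {T : Set V} {x y : ArtinGroup Γ}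
    (h : ∀ u ∈ T, Commute (gen Γ u) y) (hx : x ∈ parabolic Γ T) : Commute x y := by
  have : parabolic Γ T ≤ Subgroup.centralizer {y} := by
    rw [parabolic, Subgroup.closure_le]
    rintro _ ⟨v, hv, rfl⟩
    rw [SetLike.mem_coe, Subgroup.mem_centralizer_singleton_iff]
    exact (h v hv).eq
  exact Subgroup.mem_centralizer_singleton_iff.1 (this hx)

theorem commute_of_mem_star {v : V} {x : ArtinGroup Γ} (hx : x ∈ parabolic Γ (star Γ v)) :
    Commute x (gen Γ v) := by
  refine commute_of_mem_parabolic ?_ hx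
  rintro u (rfl | hu)
  · exact Commute.refl _
  · exact (commute_gen hu).symm

theorem lk_le_star (v : V) : lk Γ v ≤ parabolic Γ (star Γ v) :=
  parabolic_mono (Set.subset_insert _ _)

theorem commute_of_mem_lk {v : V} {x : ArtinGroup Γ} (hx : x ∈ lk Γ v) :
    Commute x (gen Γ v) :=
  commute_of_mem_star (lk_le_star v hx)

theorem commute_ltr_of_mem_lk {t : V × Bool} {x : ArtinGroup Γ} (hx : x ∈ lk Γ t.1) :
    Commute x (ltr Γ t) := by
  rcases t with ⟨v, _ | _⟩
  · exact (commute_of_mem_lk hx).inv_right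
  · exact commute_of_mem_lk hx

theorem mem_mul_left_iff {H : Subgroup (ArtinGroup Γ)} {a x : ArtinGroup Γ} (ha : a ∈ H) :
    a * x ∈ H ↔ x ∈ H := Subgroup.mul_mem_cancel_left _ ha

/-- The centralizer of a generator is the star subgroup. -/
theorem mem_star_of_commute {v : V} {x : ArtinGroup Γ} (hx : Commute x (gen Γ v)) :
    x ∈ parabolic Γ (star Γ v) := by
  classical
  -- `f` counts with sign the `v`-edges inside the star subgroup. Right multiplication by `v`
  -- preserves that subgroup and raises `f` by `1` everywhere; if `x` commutes with `v`, then `f (v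
  -- * x) = f x + 1`, which forces `x` into the star subgroup.
  obtain ⟨f, hf1, hf⟩ := exists_cocycle (Γ := Γ)
    (fun u x => if u = v ∧ x ∈ parabolic Γ (star Γ v) then 1 else 0) (by
      have key : ∀ a b x, Γ.Adj a b →
          (a = v ∧ gen Γ b * x ∈ parabolic Γ (star Γ v) ↔
            a = v ∧ x ∈ parabolic Γ (star Γ v)) := by
        intro a b x h
        refine and_congr_right fun hav => ?_
        subst hav
        exact mem_mul_left_iff (gen_mem_parabolic (Or.inr h))
      intro a b x h
      simp only [key a b x h, key b a x h.symm]
      ring)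
  have h1 : ∀ y, f (y * gen Γ v) - f y = 1 := by
    refine ltr_induction_gen (x := 1) ?_ ?_
    · have := hf v 1
      simp only [mul_one, one_mem, and_true, if_true] at this
      simp [this]
    · intro u y
      have : y * gen Γ v ∈ parabolic Γ (star Γ v) ↔ y ∈ parabolic Γ (star Γ v) :=
        Subgroup.mul_mem_cancel_right _ (gen_mem_parabolic (Or.inl rfl))
      rw [mul_assoc, hf, hf, this]
      constructor <;> intro h <;> linarith
  have h2 := h1 x
  rw [hx.eq, hf] at h2
  by_contra h
  simp [h] at h2

theorem commute_gen_iff {v : V} {x : ArtinGroup Γ} :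
    Commute x (gen Γ v) ↔ x ∈ parabolic Γ (star Γ v) :=
  ⟨mem_star_of_commute, commute_of_mem_star⟩

open Classical in
/-- The exponent sum of a generator. -/
noncomputable def expo (Γ : SimpleGraph V) (v : V) : ArtinGroup Γ →* Multiplicative ℤ :=
  liftHom (fun u => if u = v then Multiplicative.ofAdd 1 else 1) (fun _ _ _ => Commute.all _ _)

theorem expo_self (v : V) : expo Γ v (gen Γ v) = Multiplicative.ofAdd 1 := by
  rw [expo, liftHom_gen, if_pos rfl]

theorem expo_ne {u v : V} (h : u ≠ v) : expo Γ v (gen Γ u) = 1 := by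
  rw [expo, liftHom_gen, if_neg h]

theorem label_unique {u v : V} {x y : ArtinGroup Γ}
    (h : x⁻¹ * gen Γ u * x = y⁻¹ * gen Γ v * y) : u = v := by
  have := congrArg (expo Γ u) h
  simp only [map_mul, map_inv] at this
  rw [mul_right_comm, inv_mul_cancel, mul_right_comm, inv_mul_cancel, one_mul, one_mul,
    expo_self] at this
  by_contra hne
  rw [expo_ne (Ne.symm hne)] at this
  exact absurd this (by decide)

theorem gen_ne_one (v : V) : gen Γ v ≠ 1 := by
  intro h
  have := congrArg (expo Γ v) h
  rw [expo_self, map_one (expo Γ v)] at this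
  exact absurd this (by decide)

/-- The vertex `u ^ k` of the extension graph. -/
def ev (u : V) (k : ArtinGroup Γ) : ExtVertex Γ := ⟨k⁻¹ * gen Γ u * k, u, k, rfl⟩

theorem exists_ev (x : ExtVertex Γ) : ∃ u k, x = ev u k := by
  obtain ⟨x, u, k, rfl⟩ := x
  exact ⟨u, k, rfl⟩

theorem act_ev (g : ArtinGroup Γ) (u : V) (k : ArtinGroup Γ) : act Γ g (ev u k) = ev u (k * g) := by
  apply Subtype.ext
  change g⁻¹ * (k⁻¹ * gen Γ u * k) * g = (k * g)⁻¹ * gen Γ u * (k * g)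
  group

theorem ev_eq_iff {u : V} {k k' : ArtinGroup Γ} :
    ev u k = ev u k' ↔ k' * k⁻¹ ∈ parabolic Γ (star Γ u) := by
  rw [← commute_gen_iff, Subtype.ext_iff]
  change k⁻¹ * gen Γ u * k = k'⁻¹ * gen Γ u * k' ↔ k' * k⁻¹ * gen Γ u = gen Γ u * (k' * k⁻¹)
  constructor
  · intro h
    calc k' * k⁻¹ * gen Γ u = k' * (k⁻¹ * gen Γ u * k) * k⁻¹ := by group
      _ = _ := by rw [h]; group
  · intro h
    calc k⁻¹ * gen Γ u * k = k'⁻¹ * (k' * k⁻¹ * gen Γ u) * k := by group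
      _ = _ := by rw [h]; group

theorem ev_label {u u' : V} {k k' : ArtinGroup Γ} (h : ev u k = ev u' k') : u = u' :=
  label_unique (Subtype.ext_iff.1 h)

theorem ev_mul {u : V} {c k : ArtinGroup Γ} (hc : c ∈ parabolic Γ (star Γ u)) :
    ev u (c * k) = ev u k := by
  rw [eq_comm, ev_eq_iff]
  simpa using hc

theorem ev_adj {u v : V} (h : Γ.Adj u v) (k : ArtinGroup Γ) :
    (extGraph Γ).Adj (ev u k) (ev v k) := by
  refine ⟨fun he => h.ne (ev_label he), ?_⟩
  rw [commutatorElement_eq_one_iff_commute]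
  have : Commute (MulAut.conj k⁻¹ (gen Γ u)) (MulAut.conj k⁻¹ (gen Γ v)) :=
    (commute_gen h).map _
  simpa [MulAut.conj_apply, ev] using this

/-- An edge of the extension graph lies in a single conjugate of `Γ`. -/
theorem exists_of_adj {x : ExtVertex Γ} {u : V} {k : ArtinGroup Γ}
    (h : (extGraph Γ).Adj (ev u k) x) :
    ∃ v, Γ.Adj u v ∧ ∃ l ∈ lk Γ u, x = ev v (l * k) := by
  obtain ⟨v, k', rfl⟩ := exists_ev x
  obtain ⟨hne, hc⟩ := h
  rw [commutatorElement_eq_one_iff_commute] at hc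
  set m := k' * k⁻¹ with hm
  have hk' : k' = m * k := by simp [hm]
  have hc2 : Commute (m⁻¹ * gen Γ v * m) (gen Γ u) := by
    have : Commute (MulAut.conj k (ev v k').1) (MulAut.conj k (ev u k).1) := (hc.symm).map _
    have h1 : MulAut.conj k (ev v k').1 = m⁻¹ * gen Γ v * m := by
      simp [MulAut.conj_apply, ev, hm, mul_assoc]
    have h2 : MulAut.conj k (ev u k).1 = gen Γ u := by
      simp [MulAut.conj_apply, ev, mul_assoc]
    rwa [h1, h2] at this
  have hst := mem_star_of_commute hc2
  -- Split off the power of `u`.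
  have hsplit : ∀ y ∈ parabolic Γ (star Γ u), ∃ n : ℤ, y = gen Γ u ^ n * retr Γ (Γ.neighborSet u) y := by
    intro y hy
    have := parabolic_induction (Γ := Γ) (T := star Γ u) (x := 1)
      (Q := fun y => ∃ n : ℤ, y = gen Γ u ^ n * retr Γ (Γ.neighborSet u) y) ⟨0, by simp⟩ ?_ hy
    · simpa using this
    · have hgen : ∀ t : V × Bool, t.1 ∈ star Γ u →
          ∃ n : ℤ, ltr Γ t = gen Γ u ^ n * retr Γ (Γ.neighborSet u) (ltr Γ t) := by
        rintro t (ht | ht)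
        · have h0 : retr Γ (Γ.neighborSet u) (gen Γ u) = 1 := retr_gen_not_mem (by simp)
          obtain ⟨w, _ | _⟩ := t
          · obtain rfl : w = u := ht
            exact ⟨-1, by simp [ltr, h0]⟩
          · obtain rfl : w = u := ht
            exact ⟨1, by simp [ltr, h0]⟩
        · exact ⟨0, by rw [retr_eq_self (ltr_mem_parabolic ht)]; simp⟩
      rintro t ht y ⟨n, hn⟩
      obtain ⟨i, hi⟩ := hgen t ht
      refine ⟨i + n, ?_⟩
      have hcm : Commute (retr Γ (Γ.neighborSet u) (ltr Γ t)) (gen Γ u ^ n) :=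
        (commute_of_mem_lk (retr_mem' _)).zpow_right n
      conv_lhs => rw [hi, hn]
      rw [map_mul, zpow_add, mul_assoc, mul_assoc, ← mul_assoc _ (gen Γ u ^ n), hcm.eq, mul_assoc]
  obtain ⟨n, hn⟩ := hsplit _ hst
  -- Compare exponents of `u` in `m⁻¹ v m = u ^ n * l`, where `l` is in the link subgroup. If `v =
  -- u`, then `n = 1` and `l = 1`, so the two vertices coincide. Otherwise `n = 0`, and retracting
  -- shows that `v` lies in the link and that `m` may be replaced by its retraction.
  by_cases hvu : v = u
  · subst hvu
    exfalso
    have h0 : retr Γ (Γ.neighborSet v) (gen Γ v) = 1 := retr_gen_not_mem (by simp)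
    have h1 : retr Γ (Γ.neighborSet v) (m⁻¹ * gen Γ v * m) = 1 := by
      rw [map_mul, map_mul, h0, map_inv]; simp
    rw [h1, mul_one] at hn
    have h2 := congrArg (expo Γ v) hn
    simp only [map_mul, map_inv, map_zpow, expo_self] at h2
    rw [mul_right_comm, inv_mul_cancel, one_mul] at h2
    have h3 : (1 : ℤ) = n := by
      have := congrArg Multiplicative.toAdd h2
      simpa using this
    rw [← h3, zpow_one] at hn
    apply hne
    apply Subtype.ext
    change k⁻¹ * gen Γ v * k = k'⁻¹ * gen Γ v * k'
    rw [hk']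
    calc k⁻¹ * gen Γ v * k = k⁻¹ * (m⁻¹ * gen Γ v * m) * k := by rw [hn]
      _ = _ := by group
  · have h2 := congrArg (expo Γ u) hn
    have h4 : ∀ z, expo Γ u (retr Γ (Γ.neighborSet u) z) = 1 := by
      intro z
      have := retr_mem' (T := Γ.neighborSet u) z
      have hle : lk Γ u ≤ (expo Γ u).ker := by
        rw [lk, parabolic, Subgroup.closure_le]
        rintro _ ⟨w, hw, rfl⟩
        have : w ≠ u := fun h => by subst h; simp at hw
        exact expo_ne this
      exact hle this
    rw [map_mul (expo Γ u) (gen Γ u ^ n), h4] at h2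
    simp only [map_mul, map_inv, map_zpow, expo_self, expo_ne hvu] at h2
    have h3 : n = 0 := by
      have := congrArg Multiplicative.toAdd h2
      simpa using this.symm
    rw [h3, zpow_zero, one_mul, map_mul, map_mul, map_inv] at hn
    have hv : v ∈ Γ.neighborSet u := by
      by_contra hv
      rw [retr_gen_not_mem hv] at hn
      simp only [mul_one, inv_mul_cancel] at hn
      apply gen_ne_one (Γ := Γ) v
      calc gen Γ v = m * (m⁻¹ * gen Γ v * m) * m⁻¹ := by group
        _ = 1 := by rw [hn]; group
    rw [retr_gen_mem hv] at hn
    refine ⟨v, hv, retr Γ (Γ.neighborSet u) m, retr_mem' _, ?_⟩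
    apply Subtype.ext
    change k'⁻¹ * gen Γ v * k' = (_ * k)⁻¹ * gen Γ v * (_ * k)
    calc k'⁻¹ * gen Γ v * k' = k⁻¹ * (m⁻¹ * gen Γ v * m) * k := by rw [hk']; group
      _ = _ := by rw [hn]; group

theorem exists_common_of_adj {x y : ExtVertex Γ} (h : (extGraph Γ).Adj x y) :
    ∃ u v k, Γ.Adj u v ∧ x = ev u k ∧ y = ev v k := by
  obtain ⟨u, k, rfl⟩ := exists_ev x
  obtain ⟨v, huv, l, hl, rfl⟩ := exists_of_adj h
  exact ⟨u, v, l * k, huv, (ev_mul (lk_le_star u hl)).symm, rfl⟩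

theorem adj_label {u v : V} {k k' : ArtinGroup Γ} (h : (extGraph Γ).Adj (ev u k) (ev v k')) :
    Γ.Adj u v := by
  obtain ⟨u', v', k'', huv, h1, h2⟩ := exists_common_of_adj h
  rwa [ev_label h1, ev_label h2]

theorem exists_common_of_adj_ev {y : ExtVertex Γ} {u : V} {k : ArtinGroup Γ}
    (h : (extGraph Γ).Adj (ev u k) y) :
    ∃ v, Γ.Adj u v ∧ ∃ c ∈ parabolic Γ (star Γ u), y = ev v (c * k) := by
  obtain ⟨v, huv, l, hl, rfl⟩ := exists_of_adj h
  exact ⟨v, huv, l, lk_le_star u hl, rfl⟩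

end Algebra

/-! ### Half-spaces, and axes that cross each wall at most once -/

section Axes

variable {V : Type*} {Γ : SimpleGraph V}

theorem mul_mem_lk_of_adj {u v : V} (h : Γ.Adj v u) {x : ArtinGroup Γ} :
    gen Γ u * x ∈ lk Γ v ↔ x ∈ lk Γ v :=
  mem_mul_left_iff (gen_mem_parabolic h)

/-- The half-space beyond the wall which separates `1` from a letter. -/
theorem exists_side (t : V × Bool) : ∃ H : Set (ArtinGroup Γ),
    (∀ x ∈ lk Γ t.1, x ∉ H) ∧ (∀ x ∈ lk Γ t.1, ltr Γ t * x ∈ H) ∧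
    ∀ s x, (x ∈ H ↔ ltr Γ s * x ∈ H) ∨ (s = t ∧ x ∈ lk Γ t.1) ∨
      (s = inv t ∧ ltr Γ s * x ∈ lk Γ t.1) := by
  classical
  obtain ⟨v, b⟩ := t
  -- `f` counts signed crossings of a single wall, so it changes only along the edges of that wall;
  -- the half-space is its level set at `1`.
  suffices h : ∃ f : ArtinGroup Γ → ℤ, f 1 = 0 ∧
      (∀ u x, u ≠ v → f (gen Γ u * x) = f x) ∧
      ∀ x, f (ltr Γ (v, b) * x) = f x + if x ∈ lk Γ v then 1 else 0 by
    obtain ⟨f, hf1, hfu, hfv⟩ := h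
    have hfi : ∀ x, f x = f (ltr Γ (inv (v, b)) * x) +
        if ltr Γ (inv (v, b)) * x ∈ lk Γ v then 1 else 0 := by
      intro x
      rw [← hfv, ltr_inv]
      simp
    have hfu' : ∀ s x, s.1 ≠ v → f (ltr Γ s * x) = f x := by
      rintro ⟨u, _ | _⟩ x hu
      · have := hfu u ((gen Γ u)⁻¹ * x) hu
        rw [mul_inv_cancel_left] at this
        exact this.symm
      · exact hfu u x hu
    have hlk : ∀ x ∈ lk Γ v, f x = 0 := by
      intro x hx
      have := parabolic_induction (Q := fun y => f y = 0) hf1 (fun s hs y hy => by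
        have hne : s.1 ≠ v := by rintro h; rw [h] at hs; simp at hs
        rw [hfu' s y hne, hy]) hx
      simpa using this
    refine ⟨{x | f x = 1}, fun x hx => by simp [hlk x hx], fun x hx => ?_, fun s x => ?_⟩
    · simp only [Set.mem_ofPred_eq] at hx ⊢
      rw [hfv, hlk x hx, if_pos hx, zero_add]
    · by_cases hs : s.1 = v
      · by_cases hb : s.2 = b
        · obtain rfl : s = (v, b) := Prod.ext hs hb
          by_cases hx : x ∈ lk Γ v
          · exact Or.inr (Or.inl ⟨rfl, hx⟩)
          · left
            simp only [Set.mem_ofPred_eq]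
            rw [hfv, if_neg hx, add_zero]
        · obtain rfl : s = inv (v, b) := by
            refine Prod.ext hs ?_
            simp only [inv]
            revert hb
            cases s.2 <;> cases b <;> simp
          by_cases hx : ltr Γ (inv (v, b)) * x ∈ lk Γ v
          · exact Or.inr (Or.inr ⟨rfl, hx⟩)
          · left
            simp only [Set.mem_ofPred_eq]
            rw [hfi x, if_neg hx, add_zero]
      · left
        simp only [Set.mem_ofPred_eq]
        rw [hfu' s x hs]
  cases b with
  | true =>
    obtain ⟨f, hf1, hf⟩ := exists_cocycle (Γ := Γ)
      (fun u x => if u = v ∧ x ∈ lk Γ v then 1 else 0) (by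
        have key : ∀ a b x, Γ.Adj a b →
            (a = v ∧ gen Γ b * x ∈ lk Γ v ↔ a = v ∧ x ∈ lk Γ v) := by
          intro a b x h
          refine and_congr_right fun hav => ?_
          subst hav
          exact mul_mem_lk_of_adj h
        intro a b x h
        simp only [key a b x h, key b a x h.symm]
        ring)
    refine ⟨f, hf1, fun u x hu => by rw [hf]; simp [hu], fun x => ?_⟩
    change f (gen Γ v * x) = _
    rw [hf]
    simp
  | false =>
    -- For the letter `v⁻¹` the wall consists of the `v`-edges that end in the link subgroup, and
    -- traversing them forwards means coming back, hence the weight `-1`.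
    obtain ⟨f, hf1, hf⟩ := exists_cocycle (Γ := Γ)
      (fun u x => if u = v ∧ gen Γ v * x ∈ lk Γ v then -1 else 0) (by
        have key : ∀ a b x, Γ.Adj a b →
            (a = v ∧ gen Γ v * (gen Γ b * x) ∈ lk Γ v ↔ a = v ∧ gen Γ v * x ∈ lk Γ v) := by
          intro a b x h
          refine and_congr_right fun hav => ?_
          subst hav
          rw [← mul_assoc, (commute_gen h).eq, mul_assoc]
          exact mul_mem_lk_of_adj h
        intro a b x h
        simp only [key a b x h, key b a x h.symm]
        ring)
    refine ⟨f, hf1, fun u x hu => by rw [hf]; simp [hu], fun x => ?_⟩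
    change f ((gen Γ v)⁻¹ * x) = _
    have := hf v ((gen Γ v)⁻¹ * x)
    rw [mul_inv_cancel_left] at this
    simp only [true_and] at this
    split_ifs at this ⊢ <;> omega

/-- The half-space beyond the wall which separates `1` from a letter. -/
noncomputable def side (Γ : SimpleGraph V) (t : V × Bool) : Set (ArtinGroup Γ) :=
  (exists_side t).choose

theorem not_mem_side {t : V × Bool} {x : ArtinGroup Γ} (h : x ∈ lk Γ t.1) : x ∉ side Γ t :=
  (exists_side t).choose_spec.1 x h

theorem mem_side {t : V × Bool} {x : ArtinGroup Γ} (h : x ∈ lk Γ t.1) : ltr Γ t * x ∈ side Γ t :=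
  (exists_side t).choose_spec.2.1 x h

theorem side_step (t s : V × Bool) (x : ArtinGroup Γ) :
    (x ∈ side Γ t ↔ ltr Γ s * x ∈ side Γ t) ∨ (s = t ∧ x ∈ lk Γ t.1) ∨
      (s = inv t ∧ ltr Γ s * x ∈ lk Γ t.1) :=
  (exists_side t).choose_spec.2.2 s x

theorem inv_ne (t : V × Bool) : t ≠ inv t := by
  rcases t with ⟨v, _ | _⟩ <;> simp [inv]

/-- A `g`-invariant bi-infinite path in the Cayley graph, one period of which is a word of
minimal length among the words which represent conjugates of `g`. -/
structure Axis (Γ : SimpleGraph V) (g : ArtinGroup Γ) where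
  /-- the period -/
  per : ℕ
  /-- the letters -/
  c : ℤ → V × Bool
  /-- the points -/
  h : ℤ → ArtinGroup Γ
  per_pos : 0 < per
  h_succ : ∀ i, h (i + 1) = ltr Γ (c i) * h i
  h_per : ∀ i, h (i + per) = h i * g
  c_per : ∀ i, c (i + per) = c i
  minimal : ∀ i (l : List (V × Bool)), (l.map (ltr Γ)).prod = h (i + per) * (h i)⁻¹ →
    per ≤ l.length

theorem exists_word (x : ArtinGroup Γ) : ∃ l : List (V × Bool), (l.map (ltr Γ)).prod = x := by
  refine ltr_induction (Q := fun x => ∃ l : List (V × Bool), (l.map (ltr Γ)).prod = x) (x := 1)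
    ⟨[], rfl⟩ ?_ x
  rintro t y ⟨l, rfl⟩
  exact ⟨t :: l, by simp⟩

theorem exists_path (l : List (V × Bool)) (d : V × Bool) :
    ∃ (c : ℕ → V × Bool) (p : ℕ → ArtinGroup Γ),
      p 0 = 1 ∧ (∀ k, p (k + 1) = ltr Γ (c k) * p k) ∧ p l.length = (l.map (ltr Γ)).prod := by
  induction l with
  | nil =>
    exact ⟨fun _ => d, fun n => Nat.rec 1 (fun _ y => ltr Γ d * y) n, rfl, fun _ => rfl, rfl⟩
  | cons t l ih =>
    obtain ⟨c, p, h0, hs, hl⟩ := ih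
    let c' : ℕ → V × Bool := fun k => if k = l.length then t else c k
    let p' : ℕ → ArtinGroup Γ := fun n => Nat.rec 1 (fun k y => ltr Γ (c' k) * y) n
    have hp : ∀ k ≤ l.length, p' k = p k := by
      intro k
      induction k with
      | zero => intro _; exact h0.symm
      | succ k ih =>
        intro hk
        change ltr Γ (c' k) * p' k = _
        rw [ih (by omega), hs]
        simp only [c', if_neg (show k ≠ l.length by omega)]
    refine ⟨c', p', rfl, fun _ => rfl, ?_⟩
    change ltr Γ (c' l.length) * p' l.length = _
    rw [hp _ le_rfl, hl]
    simp [c']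

/-- Repeat periodically a shortest word among those representing conjugates of `g`. A period read
from any other starting point also represents a conjugate of `g`, so minimality holds at every
index. -/
theorem exists_axis {g : ArtinGroup Γ} (hg : g ≠ 1) : Nonempty (Axis Γ g) := by
  classical
  have hex : ∃ n, ∃ (r : ArtinGroup Γ) (l : List (V × Bool)), l.length = n ∧
      (l.map (ltr Γ)).prod = r * g * r⁻¹ := by
    obtain ⟨l, hl⟩ := exists_word g
    exact ⟨_, 1, l, rfl, by simpa using hl⟩
  obtain ⟨r, l, hln, hl⟩ := Nat.find_spec hex
  have hmin : ∀ (r : ArtinGroup Γ) (l' : List (V × Bool)), (l'.map (ltr Γ)).prod = r * g * r⁻¹ →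
      l.length ≤ l'.length := by
    intro r l' h
    rw [hln]
    exact Nat.find_min' hex ⟨r, l', rfl, h⟩
  have hpos : 0 < l.length := by
    rw [List.length_pos_iff]
    rintro rfl
    apply hg
    have : r * g * r⁻¹ = 1 := by simpa using hl.symm
    calc g = r⁻¹ * (r * g * r⁻¹) * r := by group
      _ = 1 := by rw [this]; group
  obtain ⟨d, -⟩ := List.length_pos_iff_exists_mem.1 hpos
  obtain ⟨c, p, h0, hs, hp⟩ := exists_path (Γ := Γ) l d
  rw [hl] at hp
  set ℓ := l.length with hℓ
  have hℓ0 : (ℓ : ℤ) ≠ 0 := by omega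
  let h : ℤ → ArtinGroup Γ := fun i => p (i % ℓ).toNat * r * g ^ (i / ℓ)
  have hper : ∀ i, h (i + ℓ) = h i * g := by
    intro i
    simp only [h]
    rw [Int.add_emod_right, Int.add_ediv_of_dvd_right (dvd_refl _), Int.ediv_self hℓ0, zpow_add_one]
    group
  refine ⟨⟨ℓ, fun i => c (i % ℓ).toNat, h, hpos, ?_, hper, ?_, ?_⟩⟩
  · intro i
    have hm0 := Int.emod_nonneg i hℓ0
    have hm1 := Int.emod_lt_of_pos i (show (0 : ℤ) < ℓ by omega)
    have hdm := Int.mul_ediv_add_emod i ℓ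
    set q := i / ℓ
    set m := i % ℓ
    rcases lt_or_eq_of_le (show m + 1 ≤ ℓ by omega) with hlt | heq
    · have h1 : (i + 1) % ℓ = m + 1 := by
        rw [← hdm, add_assoc, Int.mul_add_emod_self_left]
        exact Int.emod_eq_of_lt (by omega) hlt
      have h2 : (i + 1) / ℓ = q := by
        rw [← hdm, add_assoc, Int.mul_add_ediv_left _ _ hℓ0, Int.ediv_eq_zero_of_lt (by omega) hlt]
        simp
      change p ((i + 1) % ℓ).toNat * r * g ^ ((i + 1) / ℓ) = ltr Γ (c m.toNat) * (p m.toNat * r * g ^ q)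
      rw [h1, h2, show (m + 1).toNat = m.toNat + 1 by omega, hs]
      group
    · have h1 : (i + 1) % ℓ = 0 := by
        rw [← hdm, add_assoc, heq]; simp
      have h2 : (i + 1) / ℓ = q + 1 := by
        rw [← hdm, add_assoc, heq, Int.mul_add_ediv_left _ _ hℓ0, Int.ediv_self hℓ0]
      change p ((i + 1) % ℓ).toNat * r * g ^ ((i + 1) / ℓ) = ltr Γ (c m.toNat) * (p m.toNat * r * g ^ q)
      have h3 : ltr Γ (c m.toNat) * p m.toNat = r * g * r⁻¹ := by
        rw [← hs, ← hp]
        congr 1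
        omega
      rw [h1, h2]
      calc p (0 : ℤ).toNat * r * g ^ (q + 1) = r * g ^ (q + 1) := by simp [h0]
        _ = (r * g * r⁻¹) * r * g ^ q := by rw [add_comm, zpow_one_add]; group
        _ = _ := by rw [← h3]; group
  · intro i
    simp only [Int.add_emod_right]
  · intro i l' hl'
    rw [hper] at hl'
    exact hmin _ _ hl'

namespace Axis

variable {g : ArtinGroup Γ} (a : Axis Γ g)

/-- The half-space beyond the wall crossed by the `i`-th edge of the axis. -/
def H (i : ℤ) : Set (ArtinGroup Γ) := {x | x * (a.h i)⁻¹ ∈ side Γ (a.c i)}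

theorem H_step (i : ℤ) (s : V × Bool) (x : ArtinGroup Γ) :
    (x ∈ a.H i ↔ ltr Γ s * x ∈ a.H i) ∨ (s = a.c i ∧ x * (a.h i)⁻¹ ∈ lk Γ (a.c i).1) ∨
      (s = inv (a.c i) ∧ ltr Γ s * x * (a.h i)⁻¹ ∈ lk Γ (a.c i).1) := by
  have := side_step (a.c i) s (x * (a.h i)⁻¹)
  rwa [← mul_assoc] at this

theorem not_mem_H {i : ℤ} {x : ArtinGroup Γ} (h : x * (a.h i)⁻¹ ∈ lk Γ (a.c i).1) : x ∉ a.H i :=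
  not_mem_side h

theorem h_not_mem_H (i : ℤ) : a.h i ∉ a.H i := a.not_mem_H (by simp)

theorem h_succ_mem_H (i : ℤ) : a.h (i + 1) ∈ a.H i := by
  have := mem_side (t := a.c i) (one_mem (lk Γ (a.c i).1))
  change a.h (i + 1) * (a.h i)⁻¹ ∈ side Γ (a.c i)
  rw [a.h_succ]
  simpa using this

/-- Only a letter at the vertex that labels a wall can cross it. -/
theorem mul_mem_H_iff {i : ℤ} {T : Set V} (hT : (a.c i).1 ∉ T) {m x : ArtinGroup Γ}
    (hm : m ∈ parabolic Γ T) : m * x ∈ a.H i ↔ x ∈ a.H i := by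
  refine parabolic_induction (Q := fun y => y ∈ a.H i ↔ x ∈ a.H i) Iff.rfl ?_ hm
  intro t ht y hy
  rcases a.H_step i t y with h | ⟨rfl, -⟩ | ⟨rfl, -⟩
  · exact h.symm.trans hy
  · exact absurd ht hT
  · exact absurd ht hT

theorem exists_segment_word (i : ℤ) (n : ℕ) : ∃ l : List (V × Bool), l.length = n ∧
    (l.map (ltr Γ)).prod = a.h (i + n) * (a.h i)⁻¹ := by
  induction n with
  | zero => exact ⟨[], rfl, by simp⟩
  | succ n ih =>
    obtain ⟨l, hl, hp⟩ := ih
    refine ⟨a.c (i + n) :: l, by simp [hl], ?_⟩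
    rw [List.map_cons, List.prod_cons, hp, ← mul_assoc, ← a.h_succ]
    push_cast
    rw [add_assoc]

/-- The axis crosses a wall and crosses it back. -/
def Backtracks (i j : ℤ) : Prop :=
  a.c j = inv (a.c i) ∧ a.h (j + 1) * (a.h i)⁻¹ ∈ lk Γ (a.c i).1

theorem h_mem_H_of_not_backtracks {n : ℕ} (hn : ∀ k < n, ∀ i, ¬ a.Backtracks i (i + k)) (i : ℤ)
    (k : ℕ) (hk1 : 1 ≤ k) (hk : k ≤ n) : a.h (i + k) ∈ a.H i := by
  induction k, hk1 using Nat.le_induction with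
  | base => exact a.h_succ_mem_H i
  | succ k hk1 ih =>
    have ih := ih (by omega)
    rw [Nat.cast_succ, ← add_assoc, a.h_succ]
    rcases a.H_step i (a.c (i + k)) (a.h (i + k)) with h | ⟨-, h⟩ | ⟨h1, h2⟩
    · exact h.1 ih
    · exact absurd ih (a.not_mem_H h)
    · rw [← a.h_succ] at h2
      exact (hn k (by omega) i ⟨h1, h2⟩).elim

theorem h_not_mem_H_of_not_backtracks {n : ℕ} (hn : ∀ k < n, ∀ i, ¬ a.Backtracks i (i + k))
    (i : ℤ) (k : ℕ) (hk : k < n) : a.h (i - k) ∉ a.H i := by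
  induction k with
  | zero => simpa using a.h_not_mem_H i
  | succ k ih =>
    have ih := ih (by omega)
    set j : ℤ := i - (k + 1 : ℕ) with hj
    have hj1 : i - k = j + 1 := by rw [hj]; push_cast; ring
    have hj2 : i = j + (k + 1 : ℕ) := by rw [hj]; ring
    rw [hj1] at ih
    rcases a.H_step i (a.c j) (a.h j) with h | ⟨-, h⟩ | ⟨h1, h2⟩
    · rw [← a.h_succ] at h
      exact fun h' => ih (h.1 h')
    · exact a.not_mem_H h
    · exfalso
      rw [← a.h_succ] at h2
      refine hn (k + 1) hk j ?_
      rw [← hj2]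
      refine ⟨by rw [h1, inv_inv], ?_⟩
      have hji : (a.c j).1 = (a.c i).1 := by rw [h1]; rfl
      rw [hji]
      have h3 : a.h j = ltr Γ (a.c i) * a.h (j + 1) := by
        rw [a.h_succ j, h1, ltr_inv]; simp
      have hcm := commute_ltr_of_mem_lk h2
      rw [a.h_succ i, h3]
      have : ltr Γ (a.c i) * a.h i * (ltr Γ (a.c i) * a.h (j + 1))⁻¹ =
          (a.h (j + 1) * (a.h i)⁻¹)⁻¹ := by
        have h4 := hcm.inv_left.eq
        calc _ = ltr Γ (a.c i) * (a.h (j + 1) * (a.h i)⁻¹)⁻¹ * (ltr Γ (a.c i))⁻¹ := by group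
          _ = _ := by rw [← h4]; group
      rw [this]
      exact inv_mem h2

/-- Induct on the distance between the two crossings; up to the length already treated, the axis
stays on the expected sides of its walls. -/
theorem not_backtracks (n : ℕ) : ∀ i, ¬ a.Backtracks i (i + n) := by
  induction n using Nat.strong_induction_on with
  | _ n ih =>
    rintro i ⟨hc, hm⟩
    rcases Nat.eq_zero_or_pos n with rfl | hn
    · simp only [Nat.cast_zero, add_zero] at hc
      exact inv_ne _ hc
    have hm2 : a.h (i + n) * (a.h (i + 1))⁻¹ = a.h (i + n + 1) * (a.h i)⁻¹ := by
      have h3 : a.h (i + n) = ltr Γ (a.c i) * a.h (i + n + 1) := by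
        rw [a.h_succ (i + n), hc, ltr_inv]; simp
      have h4 := (commute_ltr_of_mem_lk hm).eq
      rw [a.h_succ i, h3]
      calc _ = ltr Γ (a.c i) * (a.h (i + n + 1) * (a.h i)⁻¹) * (ltr Γ (a.c i))⁻¹ := by group
        _ = _ := by rw [← h4]; group
    rcases lt_trichotomy n a.per with hlt | heq | hgt
    -- Both crossings lie within one period: the two inverse letters can be deleted, leaving a word
    -- of length `per - 2` for the same element.
    · obtain ⟨l1, hl1, hp1⟩ := a.exists_segment_word (i + 1) (n - 1)
      obtain ⟨l2, hl2, hp2⟩ := a.exists_segment_word (i + n + 1) (a.per - n - 1)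
      have e1 : i + 1 + ((n - 1 : ℕ) : ℤ) = i + n := by omega
      have e2 : i + n + 1 + ((a.per - n - 1 : ℕ) : ℤ) = i + a.per := by omega
      rw [e1, hm2] at hp1
      rw [e2] at hp2
      have := a.minimal i (l2 ++ l1) (by rw [List.map_append, List.prod_append, hp1, hp2]; group)
      rw [List.length_append] at this
      omega
    · rw [heq, a.c_per] at hc
      exact inv_ne _ hc
    -- The wall with index `i + per` separates `h (i + 1)` from `h (i + n)` by induction. But these
    -- two points differ by an element of the link subgroup of that wall's own label, which cannot
    -- cross it.
    · have h1 := a.h_mem_H_of_not_backtracks ih (i + a.per) (n - a.per) (by omega) (by omega)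
      have h2 := a.h_not_mem_H_of_not_backtracks ih (i + a.per) (a.per - 1)
        (by have := a.per_pos; omega)
      have := a.per_pos
      have e1 : i + a.per + ((n - a.per : ℕ) : ℤ) = i + n := by omega
      have e2 : i + a.per - ((a.per - 1 : ℕ) : ℤ) = i + 1 := by omega
      rw [e1] at h1
      rw [e2] at h2
      have h3 := a.mul_mem_H_iff (i := i + a.per) (x := a.h (i + 1))
        (T := Γ.neighborSet (a.c i).1) (by rw [a.c_per]; simp) hm
      rw [← hm2, inv_mul_cancel_right] at h3
      exact h2 (h3.1 h1)

/-- The axis crosses each wall at most once. -/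
theorem h_mem_H_iff {i j : ℤ} : a.h j ∈ a.H i ↔ i < j := by
  constructor
  · intro h
    by_contra hle
    refine a.h_not_mem_H_of_not_backtracks (n := (i - j).toNat + 1)
      (fun k _ => a.not_backtracks k) i (i - j).toNat (by omega) ?_
    convert h using 2
    omega
  · intro hlt
    have := a.h_mem_H_of_not_backtracks (n := (j - i).toNat)
      (fun k _ => a.not_backtracks k) i (j - i).toNat (by omega) (by omega)
    convert this using 2
    omega

theorem h_per_pow (i : ℤ) (n : ℕ) : a.h (i + n * a.per) = a.h i * g ^ n := by
  induction n with
  | zero => simp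
  | succ n ih =>
    rw [pow_succ, ← mul_assoc, ← ih, ← a.h_per]
    congr 1
    push_cast
    ring

end Axis

end Axes

/-! ### Short cycles: from `Γ` to the extension graph -/

section Girth

variable {V : Type*} {Γ : SimpleGraph V}

theorem not_triangle (hg : 6 ≤ Γ.egirth) {a b c : V} (h1 : Γ.Adj a b) (h2 : Γ.Adj b c)
    (h3 : Γ.Adj c a) : False := by
  have hc : (SimpleGraph.Walk.cons h1 (.cons h2 (.cons h3 .nil))).IsCycle := by
    simp [SimpleGraph.Walk.cons_isCycle_iff, SimpleGraph.Walk.cons_isPath_iff, h1.ne, h2.ne, h3.ne,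
      h1.ne', h3.ne']
  have := hg.trans (SimpleGraph.egirth_le_length hc)
  exact absurd this (by simp; decide)

theorem not_square (hg : 6 ≤ Γ.egirth) {a b c d : V} (h1 : Γ.Adj a b) (h2 : Γ.Adj b c)
    (h3 : Γ.Adj c d) (h4 : Γ.Adj d a) (hac : a ≠ c) (hbd : b ≠ d) : False := by
  have hc : (SimpleGraph.Walk.cons h1 (.cons h2 (.cons h3 (.cons h4 .nil)))).IsCycle := by
    simp [SimpleGraph.Walk.cons_isCycle_iff, SimpleGraph.Walk.cons_isPath_iff, h1.ne, h2.ne, h3.ne,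
      h1.ne', h4.ne, h4.ne', hac, hac.symm, hbd]
  have := hg.trans (SimpleGraph.egirth_le_length hc)
  exact absurd this (by simp; decide)

theorem not_pentagon (hg : 6 ≤ Γ.egirth) {a b c d e : V} (h1 : Γ.Adj a b) (h2 : Γ.Adj b c)
    (h3 : Γ.Adj c d) (h4 : Γ.Adj d e) (h5 : Γ.Adj e a) : False := by
  have hac : a ≠ c := by rintro rfl; exact not_triangle hg h3 h4 h5
  have hbd : b ≠ d := by rintro rfl; exact not_triangle hg h4 h5 h1
  have hce : c ≠ e := by rintro rfl; exact not_triangle hg h5 h1 h2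
  have had : a ≠ d := by rintro rfl; exact not_triangle hg h1 h2 h3
  have hbe : b ≠ e := by rintro rfl; exact not_triangle hg h2 h3 h4
  have hc : (SimpleGraph.Walk.cons h1 (.cons h2 (.cons h3 (.cons h4 (.cons h5 .nil))))).IsCycle := by
    simp [SimpleGraph.Walk.cons_isCycle_iff, SimpleGraph.Walk.cons_isPath_iff, h1.ne, h2.ne, h3.ne,
      h1.ne', h4.ne, h5.ne, h5.ne', hac, hac.symm, hbd, hce, had, had.symm, hbe]
  have := hg.trans (SimpleGraph.egirth_le_length hc)
  exact absurd this (by simp; decide)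

/-- The retraction onto the star subgroup of `v` fixes `k` and sends `c₂` into the subgroup of `star
w ∩ star v`, which is contained in `star b` because `Γ` has no triangles or squares. -/
theorem mem_star_of_eq_mul (hg : 6 ≤ Γ.egirth) {b v w : V} (hvb : Γ.Adj v b) (hbw : Γ.Adj b w)
    (hne : w ≠ v) {k c₁ c₂ c₃ : ArtinGroup Γ} (hk : k ∈ parabolic Γ (star Γ v))
    (h₁ : c₁ ∈ parabolic Γ (star Γ b)) (h₂ : c₂ ∈ parabolic Γ (star Γ w))
    (h₃ : c₃ ∈ parabolic Γ (star Γ b)) (h : k = c₁ * c₂ * c₃) :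
    k ∈ parabolic Γ (star Γ b) := by
  have hsub : star Γ w ∩ star Γ v ⊆ star Γ b := by
    rintro x ⟨rfl | hxw, rfl | hxv⟩
    · exact absurd rfl hne
    · exact (not_triangle hg hvb hbw hxv.symm).elim
    · exact (not_triangle hg hvb hbw hxw).elim
    · by_cases hxb : x = b
      · exact Or.inl hxb
      · exact (not_square hg hxv.symm hvb hbw hxw hxb hne.symm).elim
  rw [← retr_eq_self hk, h, map_mul, map_mul]
  exact mul_mem (mul_mem (parabolic_mono Set.inter_subset_left (retr_mem h₁))
    (parabolic_mono hsub (retr_mem h₂))) (parabolic_mono Set.inter_subset_left (retr_mem h₃))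

/-- Without triangles, the link of `x` meets the star of an adjacent `y` only in `y`. Hence
retracting onto the star subgroup of `y` sends `s ∈ lk x` to a power of `y`, and so fixes no
conjugate `s q s⁻¹` unless it equals `q`. This is applied once to remove `k` and once to remove `m`.
-/
theorem commute_of_commute_conj (hg : 6 ≤ Γ.egirth) {b v : V} (hvb : Γ.Adj v b)
    {k m : ArtinGroup Γ} (hk : k ∈ lk Γ v) (hm : m ∈ lk Γ b)
    (h : Commute (k⁻¹ * gen Γ b * k) (m⁻¹ * gen Γ v * m)) : Commute k m := by
  have hsub : ∀ {x y : V}, Γ.Adj x y → Γ.neighborSet x ∩ star Γ y ⊆ {y} := by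
    rintro x y hxy z ⟨hz1, rfl | hz2⟩
    · rfl
    · exact (not_triangle hg hxy hz2 hz1.symm).elim
  have key : ∀ {x y : V} {s q : ArtinGroup Γ}, Γ.Adj x y → s ∈ lk Γ x →
      q ∈ parabolic Γ (star Γ y) → Commute (s * q * s⁻¹) (gen Γ y) → Commute s q := by
    intro x y s q hxy hs hq hc
    have h1 := retr_eq_self (mem_star_of_commute hc)
    rw [map_mul, map_mul, retr_eq_self hq, map_inv] at h1
    have h2 : retr Γ (star Γ y) s ∈ parabolic Γ {y} := parabolic_mono (hsub hxy) (retr_mem hs)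
    have h3 : Commute (retr Γ (star Γ y) s) q :=
      commute_of_mem_parabolic (by
        rintro u rfl
        exact (commute_of_mem_star hq).symm) h2
    rw [h3.eq, mul_inv_cancel_right] at h1
    calc s * q = (s * q * s⁻¹) * s := by group
      _ = q * s := by rw [← h1]
  have hv : gen Γ v ∈ parabolic Γ (star Γ b) := gen_mem_parabolic (Or.inr hvb.symm)
  have hm' := lk_le_star b hm
  have h1 : Commute k (m⁻¹ * gen Γ v * m) := by
    refine key hvb hk (mul_mem (mul_mem (inv_mem hm') hv) hm') ?_
    have := (h.symm.map (MulAut.conj k).toMonoidHom)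
    simpa [MulAut.conj_apply, mul_assoc] using this
  refine (key hvb.symm hm (lk_le_star v hk) ?_).symm
  have := (h1.map (MulAut.conj m).toMonoidHom)
  simpa [MulAut.conj_apply, mul_assoc] using this

/-- If both alternatives fail, there is a function `f` that separates `k` from `1`, is invariant
under left multiplication by `m`, and is constant on the coset `lk v * m`. Then `f k = f (m * k) = f
(k * m) = f m = f 1`, a contradiction. -/
theorem mem_star_of_commute_lk (hg : 6 ≤ Γ.egirth) {b v : V} (hvb : Γ.Adj v b)
    {k m : ArtinGroup Γ} (hk : k ∈ lk Γ v) (hm : m ∈ lk Γ b) (h : Commute k m) :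
    k ∈ parabolic Γ (star Γ b) ∨ m ∈ parabolic Γ (star Γ v) := by
  classical
  by_contra hcon
  push Not at hcon
  obtain ⟨hkb, hmv⟩ := hcon
  set ρ := retr Γ (Γ.neighborSet v)
  -- `D c` collects the points `x` whose edge `x → c x` is parallel to one starting in `lk v`.
  -- Across these edges `f` changes as `F` does on the parallel edge in `lk v`, and across all
  -- others it is constant. The letter `b` is left out since it never changes `F`.
  let F : ArtinGroup Γ → ℤ := fun x => if x ∈ parabolic Γ (star Γ b) then 0 else 1
  let D : V → Set (ArtinGroup Γ) := fun c => {x | ∃ l ∈ lk Γ c, ∃ y ∈ lk Γ v, x = l * y}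
  let w : V → ArtinGroup Γ → ℤ := fun c x =>
    if Γ.Adj v c ∧ c ≠ b ∧ x ∈ D c then F (gen Γ c * ρ x) - F (ρ x) else 0
  have hDmul : ∀ c u x, Γ.Adj c u → (gen Γ u * x ∈ D c ↔ x ∈ D c) := by
    intro c u x hcu
    constructor
    · rintro ⟨l, hl, y, hy, he⟩
      exact ⟨(gen Γ u)⁻¹ * l, mul_mem (inv_mem (gen_mem_parabolic hcu)) hl, y, hy, by
        rw [mul_assoc, ← he]; simp⟩
    · rintro ⟨l, hl, y, hy, rfl⟩
      exact ⟨gen Γ u * l, mul_mem (gen_mem_parabolic hcu) hl, y, hy, by rw [mul_assoc]⟩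
  have hw : ∀ c u x, Γ.Adj c u → w c (gen Γ u * x) = w c x := by
    intro c u x hcu
    simp only [w, hDmul c u x hcu]
    split_ifs with hc
    · have : ρ (gen Γ u) = 1 := retr_gen_not_mem fun hu => not_triangle hg hc.1 hcu hu.symm
      rw [map_mul, this, one_mul]
    · rfl
  obtain ⟨f, hf1, hf⟩ := exists_cocycle (Γ := Γ) w (fun a c x hac => by
    rw [hw a c x hac, hw c a x hac.symm]; ring)
  have hstep : ∀ (S : Set V) (P : ArtinGroup Γ → ℤ) (x : ArtinGroup Γ),
      (∀ u ∈ S, ∀ y ∈ parabolic Γ S, f (gen Γ u * (y * x)) - f (y * x) = P (gen Γ u * y) - P y) →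
      ∀ y ∈ parabolic Γ S, f (y * x) - P y = f x - P 1 := by
    intro S P x hP y hy
    have := parabolic_induction (x := 1)
      (Q := fun y => y ∈ parabolic Γ S ∧ f (y * x) - P y = f x - P 1)
      ⟨one_mem _, by rw [one_mul]⟩ ?_ hy
    · simpa using this.2
    rintro ⟨u, _ | _⟩ hu y ⟨hy, hy'⟩
    · have hmem := mul_mem (inv_mem (gen_mem_parabolic (Γ := Γ) hu)) hy
      refine ⟨hmem, ?_⟩
      have := hP u hu _ hmem
      change f ((gen Γ u)⁻¹ * y * x) - P ((gen Γ u)⁻¹ * y) = _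
      rw [mul_assoc, mul_inv_cancel_left, mul_inv_cancel_left, ← mul_assoc] at this
      change f (y * x) - f ((gen Γ u)⁻¹ * y * x) = P y - P ((gen Γ u)⁻¹ * y) at this
      linarith
    · refine ⟨mul_mem (gen_mem_parabolic hu) hy, ?_⟩
      have := hP u hu _ hy
      change f (gen Γ u * y * x) - P (gen Γ u * y) = _
      rw [mul_assoc]
      linarith
  -- on `lk v`, `f` integrates `F`
  have hfk : f k - F k = f 1 - F 1 := by
    have := hstep (Γ.neighborSet v) F 1 (fun u hu y hy => by
      rw [hf, mul_one, add_sub_cancel_left]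
      have hρy : ρ y = y := retr_eq_self hy
      by_cases hub : u = b
      · have h1 : w u y = 0 := by simp [w, hub]
        have h2 : gen Γ u * y ∈ parabolic Γ (star Γ b) ↔ y ∈ parabolic Γ (star Γ b) :=
          mem_mul_left_iff (gen_mem_parabolic (Or.inl hub))
        simp only [h1, F, h2, sub_self]
      · simp only [w]
        rw [if_pos ⟨hu, hub, 1, one_mem _, y, hy, by simp⟩, hρy]) k hk
    simpa using this
  -- left multiplication by `lk b` does not change `f`
  have hfm : ∀ x, f (m * x) = f x := by
    intro x
    have := hstep (Γ.neighborSet b) (fun _ => 0) x (fun u hu y hy => by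
      rw [hf]
      have : ¬ Γ.Adj v u := fun huv => not_triangle hg hvb hu huv.symm
      simp [w, this]) m hm
    simpa using this
  -- `f` is constant on `lk v * m`
  have hfkm : f (k * m) = f m := by
    have := hstep (Γ.neighborSet v) (fun _ => 0) m (fun u hu y hy => by
      rw [hf]
      suffices hD : ¬ (Γ.Adj v u ∧ u ≠ b ∧ y * m ∈ D u) by simp only [w, if_neg hD]; simp
      rintro ⟨-, hub, l, hl, y', hy', he⟩
      apply hmv
      -- Retract onto `lk b`: the factors `y` and `y'` die by absence of triangles, and `l` lands in
      -- the subgroup of `lk u ∩ lk b`, which contains at most `v` by absence of squares. So `m`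
      -- would lie in the star subgroup of `v`.
      have hm2 : m = y⁻¹ * l * y' := by rw [mul_assoc, ← he]; simp
      rw [← retr_eq_self hm, hm2, map_mul, map_mul, map_inv]
      have hE : Γ.neighborSet v ∩ Γ.neighborSet b = ∅ := by
        ext z
        simp only [Set.mem_inter_iff, SimpleGraph.mem_neighborSet, Set.mem_empty_iff_false,
          iff_false, not_and]
        exact fun h1 h2 => not_triangle hg hvb h2 h1.symm
      rw [parabolic_empty hE (retr_mem hy), parabolic_empty hE (retr_mem hy')]
      have hsub : Γ.neighborSet u ∩ Γ.neighborSet b ⊆ star Γ v := by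
        rintro z ⟨hz1, hz2⟩
        by_cases hzv : z = v
        · exact Or.inl hzv
        · exact (not_square hg hu hz1 hz2.symm hvb.symm (Ne.symm hzv) hub).elim
      simpa using parabolic_mono hsub (retr_mem hl)) k hk
    simpa using this
  have h1 := hfm 1
  rw [mul_one] at h1
  have h2 : f (k * m) = f k := by rw [h.eq, hfm]
  have h3 : F 1 = 0 := by simp [F, one_mem]
  have h4 : F k = 1 := by simp [F, hkb]
  linarith

theorem ext_not_triangle (hg : 6 ≤ Γ.egirth) {a b c : ExtVertex Γ} (h1 : (extGraph Γ).Adj a b)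
    (h2 : (extGraph Γ).Adj b c) (h3 : (extGraph Γ).Adj c a) : False := by
  obtain ⟨u, k, rfl⟩ := exists_ev a
  obtain ⟨v, l, rfl⟩ := exists_ev b
  obtain ⟨w, m, rfl⟩ := exists_ev c
  exact not_triangle hg (adj_label h1) (adj_label h2) (adj_label h3)

/-- The extension graph has no squares. -/
theorem ext_not_square (hg : 6 ≤ Γ.egirth) {p z y q : ExtVertex Γ} (h1 : (extGraph Γ).Adj p z)
    (h2 : (extGraph Γ).Adj z y) (h3 : (extGraph Γ).Adj y q) (h4 : (extGraph Γ).Adj q p)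
    (hpy : p ≠ y) (hzq : z ≠ q) : False := by
  have key : ∀ {v b w : V} {h k m : ArtinGroup Γ}, Γ.Adj v b → Γ.Adj b w → w ≠ v → k ∈ lk Γ v →
      m ∈ lk Γ b → (extGraph Γ).Adj (ev w (m * h)) (ev b (k * h)) → ev b (k * h) ≠ ev b h →
      False := by
    intro v b w h k m hvb hbw hwv hk hm hadj hne
    obtain ⟨b', -, l, hl, he⟩ := exists_of_adj hadj
    obtain rfl := ev_label he
    rw [eq_comm, ev_eq_iff] at he
    apply hne
    apply ev_mul
    refine mem_star_of_eq_mul hg hvb hbw hwv (lk_le_star v hk) he (lk_le_star w hl)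
      (lk_le_star b hm) ?_
    group
  obtain ⟨v, b, h, hvb, rfl, rfl⟩ := exists_common_of_adj h2
  obtain ⟨b', hvb', k, hk, rfl⟩ := exists_of_adj h1.symm
  obtain ⟨w, hbw, m, hm, rfl⟩ := exists_of_adj h3
  have hwb' := adj_label h4
  -- The labels form a closed walk of length four in `Γ`, so some opposite pair coincides. If both
  -- pairs coincide, the commutation lemmas apply; if just one does, `key` applies.
  by_cases hb : b' = b
  · subst hb
    by_cases hw : w = v
    · subst hw
      have hc := h4.symm.2
      rw [commutatorElement_eq_one_iff_commute] at hc
      have hc' : Commute (k⁻¹ * gen Γ b' * k) (m⁻¹ * gen Γ w * m) := by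
        have := hc.map (MulAut.conj h).toMonoidHom
        simpa [MulAut.conj_apply, ev, mul_assoc] using this
      rcases mem_star_of_commute_lk hg hvb hk hm (commute_of_commute_conj hg hvb hk hm hc') with
        h5 | h5
      · exact hpy (ev_mul h5)
      · exact hzq (ev_mul h5).symm
    · exact key hvb hbw hw hk hm h4 hpy
  · by_cases hw : w = v
    · subst hw
      exact key hvb.symm hvb' hb hm hk h4.symm hzq.symm
    · exact not_square hg hvb hbw hwb' hvb'.symm (Ne.symm hw) (Ne.symm hb)

theorem ext_not_pentagon (hg : 6 ≤ Γ.egirth) {a b c d e : ExtVertex Γ}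
    (h1 : (extGraph Γ).Adj a b) (h2 : (extGraph Γ).Adj b c) (h3 : (extGraph Γ).Adj c d)
    (h4 : (extGraph Γ).Adj d e) (h5 : (extGraph Γ).Adj e a) : False := by
  obtain ⟨u1, k1, rfl⟩ := exists_ev a
  obtain ⟨u2, k2, rfl⟩ := exists_ev b
  obtain ⟨u3, k3, rfl⟩ := exists_ev c
  obtain ⟨u4, k4, rfl⟩ := exists_ev d
  obtain ⟨u5, k5, rfl⟩ := exists_ev e
  exact not_pentagon hg (adj_label h1) (adj_label h2) (adj_label h3) (adj_label h4) (adj_label h5)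

/-- A distance of `0`, `1` or `2` would close the path to a triangle, square or pentagon. -/
theorem three_le_dist (hΓ : Γ.Connected) (hg : 6 ≤ Γ.egirth) {p z y q : ExtVertex Γ}
    (h1 : (extGraph Γ).Adj p z) (h2 : (extGraph Γ).Adj z y) (h3 : (extGraph Γ).Adj y q)
    (hpy : p ≠ y) (hzq : z ≠ q) : 3 ≤ (extGraph Γ).dist p q := by
  by_contra hlt
  obtain ⟨w, hw⟩ := (extGraph_connected hΓ).exists_walk_length_eq_dist p q
  rw [← hw] at hlt
  cases w with
  | nil => exact ext_not_triangle hg h1 h2 h3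
  | cons h4 w =>
    cases w with
    | nil => exact ext_not_square hg h1 h2 h3 h4.symm hpy hzq
    | cons h5 w =>
      cases w with
      | nil => exact ext_not_pentagon hg h1 h2 h3 h5.symm h4.symm
      | cons h6 w =>
        simp only [SimpleGraph.Walk.length_cons] at hlt
        omega

/-- A geodesic between the stars of two adjacent vertices can be rerouted through one of them. -/
theorem exists_reroute (hΓ : Γ.Connected) (hg : 6 ≤ Γ.egirth) {p z y q : ExtVertex Γ}
    (hzy : (extGraph Γ).Adj z y) (hp : p = z ∨ (extGraph Γ).Adj z p)
    (hq : q = y ∨ (extGraph Γ).Adj y q) :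
    ∃ s, (s = z ∨ s = y) ∧
      (extGraph Γ).dist p s + (extGraph Γ).dist s q ≤ (extGraph Γ).dist p q := by
  by_cases h1 : p = z
  · exact ⟨z, Or.inl rfl, by simp [h1]⟩
  by_cases h2 : p = y
  · exact ⟨y, Or.inr rfl, by simp [h2]⟩
  by_cases h3 : q = z
  · exact ⟨z, Or.inl rfl, by simp [h3]⟩
  by_cases h4 : q = y
  · exact ⟨y, Or.inr rfl, by simp [h4]⟩
  have hp' := hp.resolve_left h1
  have hq' := hq.resolve_left h4
  -- In the remaining case `p, z, y, q` is a path of length three and therefore geodesic.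
  have := three_le_dist hΓ hg hp'.symm hzy hq' h2 (Ne.symm h3)
  refine ⟨z, Or.inl rfl, ?_⟩
  have d1 := SimpleGraph.dist_le (SimpleGraph.Walk.cons hp'.symm .nil)
  have d2 := SimpleGraph.dist_le (SimpleGraph.Walk.cons hzy (.cons hq' .nil))
  simp only [SimpleGraph.Walk.length_cons, SimpleGraph.Walk.length_nil] at d1 d2
  omega

end Girth

/-! ### Rerouting geodesics when consecutive letters are adjacent -/

section Transit

variable {V : Type*} {Γ : SimpleGraph V}

/-- Every geodesic from a point of `S` to a far translate of `e` can be rerouted through the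
translate of `S` by `g`. -/
def Transit (Γ : SimpleGraph V) (g : ArtinGroup Γ) (S : Set (ExtVertex Γ)) (e : ExtVertex Γ) :
    Prop :=
  ∀ s ∈ S, ∀ n : ℕ, 1 ≤ n → ∃ s' ∈ S,
    (extGraph Γ).dist s (act Γ g s') + (extGraph Γ).dist (act Γ g s') (act Γ (g ^ n) e) ≤
      (extGraph Γ).dist s (act Γ (g ^ n) e)

theorem dist_add_dist_of_mem_support {W : Type*} {G : SimpleGraph W} {s e x y : W}
    (p : G.Walk s e) (hx : x ∈ p.support) (hy : y ∈ p.support) :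
    G.dist s x + G.dist x y + G.dist y e ≤ p.length ∨
      G.dist s y + G.dist y x + G.dist x e ≤ p.length := by
  obtain ⟨p1, p2, rfl⟩ := SimpleGraph.Walk.mem_support_iff_exists_append.1 hx
  rw [SimpleGraph.Walk.mem_support_append_iff] at hy
  rw [SimpleGraph.Walk.length_append]
  rcases hy with hy | hy
  · right
    obtain ⟨p3, p4, rfl⟩ := SimpleGraph.Walk.mem_support_iff_exists_append.1 hy
    rw [SimpleGraph.Walk.length_append]
    have := SimpleGraph.dist_le p2
    have := SimpleGraph.dist_le p3
    have := SimpleGraph.dist_le p4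
    omega
  · left
    obtain ⟨p3, p4, rfl⟩ := SimpleGraph.Walk.mem_support_iff_exists_append.1 hy
    rw [SimpleGraph.Walk.length_append]
    have := SimpleGraph.dist_le p1
    have := SimpleGraph.dist_le p3
    have := SimpleGraph.dist_le p4
    omega

namespace Axis

variable {g : ArtinGroup Γ} (a : Axis Γ g)

theorem act_ev_h (u : V) (i : ℤ) (n : ℕ) :
    act Γ (g ^ n) (ev u (a.h i)) = ev u (a.h (i + n * a.per)) := by
  rw [act_ev, a.h_per_pow]

theorem act_ev_h_one (u : V) (i : ℤ) :
    act Γ g (ev u (a.h i)) = ev u (a.h (i + a.per)) := by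
  rw [act_ev, a.h_per]

/-- The vertex of the extension graph whose star contains the `i`-th wall. -/
def center (i : ℤ) : ExtVertex Γ := ev (a.c i).1 (a.h i)

theorem near_center_of_mem_lk {i : ℤ} {u : V} {x : ArtinGroup Γ} (hu : (a.c i).1 ∈ star Γ u)
    (hx : x * (a.h i)⁻¹ ∈ lk Γ (a.c i).1) :
    ev u x = a.center i ∨ (extGraph Γ).Adj (a.center i) (ev u x) := by
  have h1 : ev (a.c i).1 x = a.center i := by
    have := ev_mul (lk_le_star _ hx) (k := a.h i)
    rwa [inv_mul_cancel_right] at this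
  rcases hu with hu | hu
  · left
    rw [← h1, hu]
  · right
    rw [← h1]
    exact ev_adj (Γ.adj_symm hu) x

/-- All elements of the coset of `k` under the star subgroup of `u` name the same vertex `u^k`. A
path inside the coset that crosses the wall does so by a letter of `star u`, so the label of the
wall is `u` or adjacent to it. -/
theorem near_center_of_cross {i : ℤ} {u : V} {c k : ArtinGroup Γ}
    (hc : c ∈ parabolic Γ (star Γ u)) (hk : k ∉ a.H i) (hck : c * k ∈ a.H i) :
    ev u k = a.center i ∨ (extGraph Γ).Adj (a.center i) (ev u k) := by
  have := parabolic_induction (x := k)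
    (Q := fun y => ev u y = ev u k ∧ (y ∈ a.H i →
      (ev u k = a.center i ∨ (extGraph Γ).Adj (a.center i) (ev u k))))
    ⟨rfl, fun h => absurd h hk⟩ ?_ hc
  · exact this.2 hck
  rintro t ht y ⟨hy, hyH⟩
  have hty : ev u (ltr Γ t * y) = ev u k := by rw [ev_mul (ltr_mem_parabolic ht), hy]
  refine ⟨hty, fun hH => ?_⟩
  rcases a.H_step i t y with h | ⟨rfl, h⟩ | ⟨rfl, h⟩
  · exact hyH (h.2 hH)
  · rw [← hy]
    exact a.near_center_of_mem_lk ht h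
  · rw [← hty]
    exact a.near_center_of_mem_lk ht h

/-- A path of the extension graph from one side of a wall to the other passes through the star of
its center. -/
theorem exists_mem_support_near_center {i : ℤ} {x y : ExtVertex Γ} (p : (extGraph Γ).Walk x y)
    {u u' : V} {k k' : ArtinGroup Γ} (hx : x = ev u k) (hy : y = ev u' k') (hk : k ∉ a.H i)
    (hk' : k' ∈ a.H i) :
    ∃ q ∈ p.support, q = a.center i ∨ (extGraph Γ).Adj (a.center i) q := by
  induction p generalizing u k with
  | nil =>
    have he := hx.symm.trans hy
    obtain rfl := ev_label he
    rw [ev_eq_iff] at he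
    refine ⟨_, SimpleGraph.Walk.start_mem_support _, ?_⟩
    rw [hx]
    exact a.near_center_of_cross he hk (by simpa using hk')
  | cons h p ih =>
    subst hx
    obtain ⟨v, -, c, hc, hv⟩ := exists_common_of_adj_ev h
    by_cases hck : c * k ∈ a.H i
    · exact ⟨_, SimpleGraph.Walk.start_mem_support _, a.near_center_of_cross hc hk hck⟩
    · obtain ⟨q, hq, hq'⟩ := ih hv hy hck
      exact ⟨q, by rw [SimpleGraph.Walk.support_cons]; exact List.mem_cons_of_mem _ hq, hq'⟩

/-- The walls `i + per` and `i + 1 + per` separate the start from the target, and their centers are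
adjacent. A geodesic meets both stars, so `exists_reroute` applies to the piece in between. Basing
`e` at `h (i + 2)` puts its translates beyond both walls already for `n = 1`. -/
theorem transit_of_adj (hΓ : Γ.Connected) (hg : 6 ≤ Γ.egirth) {i : ℤ}
    (hadj : Γ.Adj (a.c i).1 (a.c (i + 1)).1) :
    Transit Γ g {ev (a.c i).1 (a.h i), ev (a.c (i + 1)).1 (a.h i)}
      (ev (a.c i).1 (a.h (i + 2))) := by
  intro s hs n hn
  have hpos := a.per_pos
  obtain ⟨u, rfl⟩ : ∃ u, s = ev u (a.h i) := by
    rcases hs with rfl | rfl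
    exacts [⟨_, rfl⟩, ⟨_, rfl⟩]
  rw [a.act_ev_h]
  obtain ⟨p, hp⟩ := (extGraph_connected hΓ).exists_walk_length_eq_dist (ev u (a.h i))
    (ev (a.c i).1 (a.h (i + 2 + n * a.per)))
  have hle : (a.per : ℤ) ≤ n * a.per := by
    have : (1 : ℤ) ≤ n := by exact_mod_cast hn
    nlinarith
  obtain ⟨x, hx, hxz⟩ := a.exists_mem_support_near_center (i := i + a.per) p rfl rfl
    (fun h => by have := a.h_mem_H_iff.1 h; omega) (a.h_mem_H_iff.2 (by omega))
  obtain ⟨y, hy, hyz⟩ := a.exists_mem_support_near_center (i := i + 1 + a.per) p rfl rfl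
    (fun h => by have := a.h_mem_H_iff.1 h; omega) (a.h_mem_H_iff.2 (by omega))
  have hc1 : a.center (i + a.per) = act Γ g (ev (a.c i).1 (a.h i)) := by
    rw [a.act_ev_h_one, center, a.c_per]
  -- This center is based one letter further along the axis, but that letter is adjacent to its
  -- label and does not change the vertex.
  have hc2 : a.center (i + 1 + a.per) = act Γ g (ev (a.c (i + 1)).1 (a.h i)) := by
    rw [a.act_ev_h_one, center, a.c_per, add_right_comm, a.h_succ, a.c_per]
    exact ev_mul (ltr_mem_parabolic (Or.inr hadj.symm))
  rw [hc1] at hxz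
  rw [hc2] at hyz
  obtain ⟨s', hs', hd⟩ := exists_reroute hΓ hg
    ((act Γ g).map_adj_iff.2 (ev_adj hadj (a.h i))) hxz hyz
  have hfin : (extGraph Γ).dist (ev u (a.h i)) s' +
      (extGraph Γ).dist s' (ev (a.c i).1 (a.h (i + 2 + n * a.per))) ≤
      (extGraph Γ).dist (ev u (a.h i)) (ev (a.c i).1 (a.h (i + 2 + n * a.per))) := by
    rw [← hp]
    have hcn := extGraph_connected hΓ
    rcases dist_add_dist_of_mem_support p hx hy with h | h
    · have h1 := hcn.dist_triangle (u := ev u (a.h i)) (v := x) (w := s')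
      have h2 := hcn.dist_triangle (u := s') (v := y)
        (w := ev (a.c i).1 (a.h (i + 2 + n * a.per)))
      omega
    · have h1 := hcn.dist_triangle (u := ev u (a.h i)) (v := y) (w := s')
      have h2 := hcn.dist_triangle (u := s') (v := x)
        (w := ev (a.c i).1 (a.h (i + 2 + n * a.per)))
      rw [SimpleGraph.dist_comm (u := y) (v := s')] at h1
      rw [SimpleGraph.dist_comm (u := s') (v := x)] at h2
      rw [SimpleGraph.dist_comm (u := y) (v := x)] at h
      omega
  rcases hs' with rfl | rfl
  · exact ⟨_, Or.inl rfl, hfin⟩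
  · exact ⟨_, Or.inr rfl, hfin⟩

/-! ### Projection to the axis when no consecutive letters are adjacent -/

/-- The position of the projection of a group element to the axis. -/
def Pos (x : ArtinGroup Γ) (n : ℤ) : Prop := x ∉ a.H n ∧ x ∈ a.H (n - 1)

theorem pos_h_iff {i n : ℤ} : a.Pos (a.h i) n ↔ n = i := by
  rw [Pos, a.h_mem_H_iff, a.h_mem_H_iff]
  omega

variable {a}

/-- After a crossing of wall `n` the element differs from `h (n + 1)` by an element of the link
subgroup of `c n`. Since `c (n + 1)` is not in this link, wall `n + 1` has not been crossed, so
positions move by at most one per letter; the same holds backwards. -/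
theorem Pos.step (ha : ∀ i, ¬ Γ.Adj (a.c i).1 (a.c (i + 1)).1) {x : ArtinGroup Γ} {n : ℤ}
    (hx : a.Pos x n) (t : V × Bool) :
    a.Pos (ltr Γ t * x) n ∨ (a.Pos (ltr Γ t * x) (n + 1) ∧ t.1 = (a.c n).1) ∨
      (a.Pos (ltr Γ t * x) (n - 1) ∧ t.1 = (a.c (n - 1)).1) := by
  obtain ⟨hx1, hx2⟩ := hx
  by_cases h1 : ltr Γ t * x ∈ a.H n
  · rcases a.H_step n t x with h | ⟨rfl, h⟩ | ⟨-, h⟩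
    · exact absurd (h.2 h1) hx1
    · refine Or.inr (Or.inl ⟨⟨?_, by rwa [add_sub_cancel_right]⟩, rfl⟩)
      have h2 : ltr Γ (a.c n) * x = x * (a.h n)⁻¹ * a.h (n + 1) := by
        rw [a.h_succ, ← mul_assoc, (commute_ltr_of_mem_lk h).eq]
        group
      rw [h2, a.mul_mem_H_iff (ha n) h]
      exact a.h_not_mem_H _
    · exact absurd h1 (a.not_mem_H h)
  by_cases h2 : ltr Γ t * x ∈ a.H (n - 1)
  · exact Or.inl ⟨h1, h2⟩
  rcases a.H_step (n - 1) t x with h | ⟨rfl, h⟩ | ⟨rfl, h⟩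
  · exact absurd (h.1 hx2) h2
  · exact absurd hx2 (a.not_mem_H h)
  · refine Or.inr (Or.inr ⟨⟨h2, ?_⟩, rfl⟩)
    have h3 := ha (n - 1 - 1)
    rw [sub_add_cancel] at h3
    have h4 := a.mul_mem_H_iff (i := n - 1 - 1) (x := a.h (n - 1)) (fun h => h3 (Γ.adj_symm h)) h
    rw [inv_mul_cancel_right] at h4
    rw [h4, a.h_mem_H_iff]
    omega

variable (a) in
/-- All letters of the axis between two positions lie in the star of `u`. -/
def InStar (u : V) (n n' : ℤ) : Prop :=
  ∀ j, (n ≤ j ∧ j < n' ∨ n' ≤ j ∧ j < n) → (a.c j).1 ∈ star Γ u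

theorem Pos.star_mul (ha : ∀ i, ¬ Γ.Adj (a.c i).1 (a.c (i + 1)).1) {c k : ArtinGroup Γ} {n : ℤ}
    (hk : a.Pos k n) {u : V} (hc : c ∈ parabolic Γ (star Γ u)) :
    ∃ n', a.Pos (c * k) n' ∧ a.InStar u n n' := by
  refine parabolic_induction (Q := fun y => ∃ n', a.Pos y n' ∧ a.InStar u n n')
    ⟨n, hk, fun j hj => by omega⟩ ?_ hc
  rintro t ht y ⟨n', hy, hn'⟩
  rcases hy.step ha t with h | ⟨h, he⟩ | ⟨h, he⟩
  · exact ⟨n', h, hn'⟩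
  · refine ⟨n' + 1, h, fun j hj => ?_⟩
    by_cases hjn : j = n'
    · rw [hjn, ← he]; exact ht
    · exact hn' j (by omega)
  · refine ⟨n' - 1, h, fun j hj => ?_⟩
    by_cases hjn : j = n' - 1
    · rw [hjn, ← he]; exact ht
    · exact hn' j (by omega)

variable (a) in
theorem segment_mem_parabolic {T : Set V} (n : ℤ) (k : ℕ)
    (h : ∀ j, n ≤ j → j < n + k → (a.c j).1 ∈ T) : a.h (n + k) * (a.h n)⁻¹ ∈ parabolic Γ T := by
  induction k with
  | zero => simp
  | succ k ih =>
    rw [Nat.cast_succ, ← add_assoc, a.h_succ, mul_assoc]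
    exact mul_mem (ltr_mem_parabolic (h _ (by omega) (by push_cast; omega)))
      (ih fun j h1 h2 => h j h1 (by push_cast; omega))

variable (a) in
theorem ev_eq_of_le {u : V} {n n' : ℤ} (hle : n ≤ n')
    (h : ∀ j, n ≤ j → j < n' → (a.c j).1 ∈ star Γ u) : ev u (a.h n) = ev u (a.h n') := by
  rw [ev_eq_iff]
  have := a.segment_mem_parabolic n (n' - n).toNat (T := star Γ u)
    (fun j h1 h2 => h j h1 (by omega))
  rwa [show n + ((n' - n).toNat : ℤ) = n' by omega] at this

theorem InStar.ev_eq {u : V} {n n' : ℤ} (h : a.InStar u n n') :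
    ev u (a.h n) = ev u (a.h n') := by
  rcases le_total n n' with hle | hle
  · exact a.ev_eq_of_le hle fun j h1 h2 => h j (by omega)
  · exact (a.ev_eq_of_le hle fun j h1 h2 => h j (by omega)).symm

/-- The letter after a `u` is either `u` or adjacent to `u`, and adjacency is excluded by `ha`. -/
theorem InStar.eq_of_eq (ha : ∀ i, ¬ Γ.Adj (a.c i).1 (a.c (i + 1)).1) {u : V} {n n' i : ℤ}
    (h : a.InStar u n n') (hni : n ≤ i) (hi : (a.c i).1 = u) (k : ℕ) (hk : i + k < n') :
    (a.c (i + k)).1 = u := by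
  induction k with
  | zero => simpa using hi
  | succ k ih =>
    have ih := ih (by push_cast at hk; omega)
    rcases h (i + (k + 1 : ℕ)) (by push_cast at *; omega) with h1 | h1
    · exact h1
    · have h2 := ha (i + k)
      rw [ih, add_assoc] at h2
      exact absurd (by exact_mod_cast h1) h2

/-- Projecting a path of the extension graph to the axis. -/
theorem Pos.dist_le (hΓ : Γ.Connected) (ha : ∀ i, ¬ Γ.Adj (a.c i).1 (a.c (i + 1)).1)
    {x y : ExtVertex Γ} (p : (extGraph Γ).Walk x y) {u u' : V} {k : ArtinGroup Γ} {n M : ℤ}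
    (hx : x = ev u k) (hy : y = ev u' (a.h M)) (hk : a.Pos k n) :
    (extGraph Γ).dist (ev u (a.h n)) (ev u' (a.h M)) ≤ p.length := by
  induction p generalizing u k n with
  | nil =>
    have he := hx.symm.trans hy
    obtain rfl := ev_label he
    obtain ⟨n', hn', hst⟩ := hk.star_mul ha (ev_eq_iff.1 he)
    rw [inv_mul_cancel_right, a.pos_h_iff] at hn'
    subst hn'
    rw [hst.ev_eq]
    simp
  | cons h p ih =>
    subst hx
    obtain ⟨v, huv, c, hc, hv⟩ := exists_common_of_adj_ev h
    obtain ⟨n', hn', hst⟩ := hk.star_mul ha hc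
    have h1 := ih hv hy hn'
    -- Moving the representative within the star subgroup of `u` shifts the position only over
    -- letters in `star u`, so the projected vertex stays put and the edge projects to an edge.
    rw [hst.ev_eq, SimpleGraph.Walk.length_cons]
    have h2 := (extGraph_connected hΓ).dist_triangle (u := ev u (a.h n')) (v := ev v (a.h n'))
      (w := ev u' (a.h M))
    have h3 := SimpleGraph.dist_eq_one_iff_adj.2 (ev_adj huv (a.h n'))
    omega

/-- A path along the axis crosses each link of a wall. -/
theorem Pos.exists_dist_add_dist_le (hΓ : Γ.Connected)
    (ha : ∀ i, ¬ Γ.Adj (a.c i).1 (a.c (i + 1)).1)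
    {x y : ExtVertex Γ} (p : (extGraph Γ).Walk x y) {u u' : V} {k : ArtinGroup Γ} {n i M : ℤ}
    (hx : x = ev u k) (hy : y = ev u' (a.h M)) (hk : a.Pos k n) (hni : n ≤ i) (hiM : i < M)
    (hu' : u' ≠ (a.c i).1) :
    ∃ w, Γ.Adj (a.c i).1 w ∧
      (extGraph Γ).dist (ev u (a.h n)) (ev w (a.h i)) +
        (extGraph Γ).dist (ev w (a.h i)) (ev u' (a.h M)) ≤ p.length := by
  induction p generalizing u k n with
  | nil =>
    have he := hx.symm.trans hy
    obtain rfl := ev_label he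
    obtain ⟨n', hn', hst⟩ := hk.star_mul ha (ev_eq_iff.1 he)
    rw [inv_mul_cancel_right, a.pos_h_iff] at hn'
    subst hn'
    -- At the end of the path no further vertex is available to serve as `w`; `hu'` rules out the
    -- case that would need one.
    have h1 := (hst i (Or.inl ⟨hni, hiM⟩)).resolve_left (Ne.symm hu')
    refine ⟨u, Γ.adj_symm h1, ?_⟩
    rw [← a.ev_eq_of_le hni fun j h1 h2 => hst j (by omega), hst.ev_eq]
    simp
  | cons h p ih =>
    subst hx
    obtain ⟨v, huv, c, hc, hv⟩ := exists_common_of_adj_ev h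
    obtain ⟨n', hn', hst⟩ := hk.star_mul ha hc
    rcases le_or_gt n' i with hn'i | hn'i
    · obtain ⟨w, hw, hd⟩ := ih hv hy hn' hn'i
      refine ⟨w, hw, ?_⟩
      rw [hst.ev_eq, SimpleGraph.Walk.length_cons]
      have h2 := (extGraph_connected hΓ).dist_triangle (u := ev u (a.h n')) (v := ev v (a.h n'))
        (w := ev w (a.h i))
      have h3 := SimpleGraph.dist_eq_one_iff_adj.2 (ev_adj huv (a.h n'))
      omega
    -- The projection jumps over position `i` in one step. If `c i` is at `u`, all letters from
    -- there to `n'` are at `u`, and the next vertex `v` serves as `w`. If `c i` is adjacent to `u`,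
    -- then `u` itself serves.
    rcases hst i (Or.inl ⟨hni, hn'i⟩) with hi | hi
    · refine ⟨v, by rwa [hi], ?_⟩
      have h1 : ev v (a.h i) = ev v (a.h n') := by
        refine a.ev_eq_of_le hn'i.le fun j h1 h2 => ?_
        have := hst.eq_of_eq ha hni hi (j - i).toNat (by omega)
        rw [show i + ((j - i).toNat : ℤ) = j by omega] at this
        rw [this]
        exact Or.inr huv.symm
      have h2 := Pos.dist_le hΓ ha p hv hy hn'
      have h3 := SimpleGraph.dist_eq_one_iff_adj.2 (ev_adj huv (a.h n'))
      rw [h1, hst.ev_eq, SimpleGraph.Walk.length_cons]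
      omega
    · refine ⟨u, Γ.adj_symm hi, ?_⟩
      have h1 : ev u (a.h n) = ev u (a.h i) := a.ev_eq_of_le hni fun j h1 h2 => hst j (by omega)
      have h2 := Pos.dist_le hΓ ha (SimpleGraph.Walk.cons h p) rfl hy hk
      rw [← h1, SimpleGraph.dist_self]
      omega

-- The projected path passes position `i + per`, hence the copy of the link of `c i` there. The
-- label `b` of the target is chosen adjacent to `c i`, and thus distinct from it, as the crossing
-- lemma requires.
variable (a) in
theorem transit_of_not_adj (hΓ : Γ.Connected) (ha : ∀ i, ¬ Γ.Adj (a.c i).1 (a.c (i + 1)).1)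
    (i : ℤ) {b : V} (hb : Γ.Adj (a.c i).1 b) :
    Transit Γ g ((fun w => ev w (a.h i)) '' Γ.neighborSet (a.c i).1) (ev b (a.h (i + 1))) := by
  rintro _ ⟨u, hu, rfl⟩ n hn
  have hpos := a.per_pos
  have hle : (a.per : ℤ) ≤ n * a.per := by
    have : (1 : ℤ) ≤ n := by exact_mod_cast hn
    nlinarith
  dsimp only
  rw [a.act_ev_h]
  obtain ⟨p, hp⟩ := (extGraph_connected hΓ).exists_walk_length_eq_dist (ev u (a.h i))
    (ev b (a.h (i + 1 + n * a.per)))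
  obtain ⟨w, hw, hd⟩ := Pos.exists_dist_add_dist_le (i := i + a.per) hΓ ha p rfl rfl
    (a.pos_h_iff.2 rfl) (by omega) (by omega) (by rw [a.c_per]; exact hb.ne')
  rw [a.c_per] at hw
  refine ⟨_, ⟨w, hw, rfl⟩, ?_⟩
  dsimp only
  rw [a.act_ev_h_one, ← hp]
  exact hd

end Axis

end Transit

/-! ### From rerouting to periodic geodesics -/

section Periodic

variable {V : Type*} {Γ : SimpleGraph V}

theorem act_one (x : ExtVertex Γ) : act Γ 1 x = x := by
  obtain ⟨u, k, rfl⟩ := exists_ev x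
  rw [act_ev, mul_one]

theorem dist_act_pow_le (hΓ : Γ.Connected) (f : ArtinGroup Γ) (x : ExtVertex Γ) (n : ℕ) :
    (extGraph Γ).dist x (act Γ (f ^ n) x) ≤ n * (extGraph Γ).dist x (act Γ f x) := by
  induction n with
  | zero => simp [act_one]
  | succ n ih =>
    have h1 := (extGraph_connected hΓ).dist_triangle (u := x) (v := act Γ f x)
      (w := act Γ (f ^ (n + 1)) x)
    rw [pow_succ, act_mul, dist_act hΓ] at h1
    rw [pow_succ, act_mul]
    linarith

/-- By subadditivity, the displacement by `g ^ (n * k)` is at most `k` times the displacement by `g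
^ n`; let `k` grow. -/
theorem mul_translationLength_le (hΓ : Γ.Connected) {g : ArtinGroup Γ} {τ : ℝ}
    (hτ : IsTranslationLength Γ g τ) (x : ExtVertex Γ) (n : ℕ) :
    n * τ ≤ (extGraph Γ).dist x (act Γ (g ^ n) x) := by
  rcases Nat.eq_zero_or_pos n with rfl | hn
  · simp
  have hn' : (0 : ℝ) < n := by exact_mod_cast hn
  have h1 : Tendsto (fun k : ℕ => n * k) atTop atTop :=
    tendsto_id.const_mul_atTop' hn
  have h2 := (hτ x).comp h1
  rw [← le_div_iff₀' hn']
  refine le_of_tendsto h2 ?_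
  filter_upwards [eventually_ge_atTop 1] with k hk
  have hk' : (0 : ℝ) < k := by exact_mod_cast hk
  have h3 := dist_act_pow_le hΓ (g ^ n) x k
  rw [← pow_mul] at h3
  have h4 : ((extGraph Γ).dist x (act Γ (g ^ (n * k)) x) : ℝ) ≤
      k * (extGraph Γ).dist x (act Γ (g ^ n) x) := by exact_mod_cast h3
  simp only [Function.comp_apply, Nat.cast_mul]
  rw [div_le_div_iff₀ (by positivity) hn']
  nlinarith

theorem dist_act_pow_le_sum (hΓ : Γ.Connected) (g : ArtinGroup Γ) (q : ℕ → ExtVertex Γ)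
    (i d : ℕ) : (extGraph Γ).dist (q i) (act Γ (g ^ d) (q (i + d))) ≤
      ∑ k ∈ Finset.range d, (extGraph Γ).dist (q (i + k)) (act Γ g (q (i + k + 1))) := by
  induction d with
  | zero => simp [act_one]
  | succ d ih =>
    rw [Finset.sum_range_succ]
    have h1 := (extGraph_connected hΓ).dist_triangle (u := q i) (v := act Γ (g ^ d) (q (i + d)))
      (w := act Γ (g ^ (d + 1)) (q (i + (d + 1))))
    rw [pow_succ' g d, act_mul, dist_act hΓ, ← add_assoc] at h1
    rw [pow_succ' g d, act_mul, ← add_assoc]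
    omega

/-- Removing loops: a walk through a finite set all of whose short loops have mean weight at least
`μ` has mean weight almost `μ`. -/
theorem mul_le_sum_dist (hΓ : Γ.Connected) {g : ArtinGroup Γ} {S : Finset (ExtVertex Γ)} {μ : ℝ}
    (hμ0 : 0 ≤ μ) (hμ : ∀ p ∈ S, ∀ m : ℕ, 1 ≤ m → m ≤ S.card →
      m * μ ≤ (extGraph Γ).dist p (act Γ (g ^ m) p)) (n : ℕ) :
    ∀ q : ℕ → ExtVertex Γ, (∀ i, q i ∈ S) → (n - S.card) * μ ≤
      ((∑ k ∈ Finset.range n, (extGraph Γ).dist (q k) (act Γ g (q (k + 1))) : ℕ) : ℝ) := by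
  induction n using Nat.strong_induction_on with
  | _ n ih =>
    intro q hq
    rcases le_or_gt n S.card with hn | hn
    · have h1 : ((n : ℝ) - S.card) * μ ≤ 0 := by
        have : (n : ℝ) ≤ S.card := by exact_mod_cast hn
        nlinarith
      exact h1.trans (Nat.cast_nonneg _)
    -- Among the first `S.card + 1` points two coincide. The loop between them costs at least `μ`
    -- per step; excise it to get `q'` and induct.
    obtain ⟨i, j, hij, hjS, hqij⟩ : ∃ i j, i < j ∧ j ≤ S.card ∧ q i = q j := by
      obtain ⟨i, hi, j, hj, hne, he⟩ := Finset.exists_ne_map_eq_of_card_lt_of_maps_to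
        (s := Finset.range (S.card + 1)) (t := S) (by simp) (f := q) (fun i _ => hq i)
      simp only [Finset.mem_range] at hi hj
      rcases lt_or_gt_of_ne hne with h | h
      · exact ⟨i, j, h, by omega, he⟩
      · exact ⟨j, i, h, by omega, he.symm⟩
    obtain ⟨d, rfl⟩ := Nat.exists_eq_add_of_lt hij
    obtain ⟨r, rfl⟩ := Nat.exists_eq_add_of_le (show i + (d + 1) ≤ n by omega)
    rw [add_assoc] at hqij
    let q' : ℕ → ExtVertex Γ := fun k => if k ≤ i then q k else q (k + (d + 1))
    have h1 := ih (i + r) (by omega) q' (fun k => by simp only [q']; split_ifs <;> exact hq _)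
    rw [Finset.sum_range_add] at h1 ⊢
    rw [Finset.sum_range_add]
    have e1 : ∑ k ∈ Finset.range i, (extGraph Γ).dist (q' k) (act Γ g (q' (k + 1))) =
        ∑ k ∈ Finset.range i, (extGraph Γ).dist (q k) (act Γ g (q (k + 1))) := by
      refine Finset.sum_congr rfl fun k hk => ?_
      have := Finset.mem_range.1 hk
      simp only [q', if_pos (show k ≤ i by omega), if_pos (show k + 1 ≤ i by omega)]
    have e2 : ∀ k, q' (i + k) = q (i + (d + 1) + k) := by
      intro k
      simp only [q']
      split_ifs with h
      · obtain rfl : k = 0 := by omega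
        simpa using hqij
      · congr 1; omega
    have e3 : ∑ k ∈ Finset.range r, (extGraph Γ).dist (q' (i + k)) (act Γ g (q' (i + k + 1))) =
        ∑ k ∈ Finset.range r, (extGraph Γ).dist (q (i + (d + 1) + k))
          (act Γ g (q (i + (d + 1) + k + 1))) := by
      refine Finset.sum_congr rfl fun k _ => ?_
      rw [e2 k, add_assoc i k 1, e2 (k + 1)]
      rfl
    rw [e1, e3] at h1
    have h2 := dist_act_pow_le_sum hΓ g q i (d + 1)
    rw [← hqij] at h2
    have h3 := hμ (q i) (hq i) (d + 1) (by omega) (by omega)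
    have h4 : ((extGraph Γ).dist (q i) (act Γ (g ^ (d + 1)) (q i)) : ℝ) ≤
      ((∑ k ∈ Finset.range (d + 1), (extGraph Γ).dist (q (i + k)) (act Γ g (q (i + k + 1))) : ℕ) :
        ℝ) := by exact_mod_cast h2
    rw [Nat.cast_add] at h1
    rw [Nat.cast_add, Nat.cast_add]
    push_cast at h1 h3 h4 ⊢
    nlinarith

/-- If geodesics can be rerouted through the translates of a finite set `S`, then the translation
length is realized by a power at most `|S|`. -/
theorem Transit.exists_dist_le (hΓ : Γ.Connected) {g : ArtinGroup Γ} {τ : ℝ}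
    (hτ : IsTranslationLength Γ g τ) {S : Finset (ExtVertex Γ)} (hS : S.Nonempty)
    {e : ExtVertex Γ} (hT : Transit Γ g S e) :
    ∃ p, ∃ m : ℕ, 1 ≤ m ∧ m ≤ S.card ∧ ((extGraph Γ).dist p (act Γ (g ^ m) p) : ℝ) ≤ m * τ := by
  by_contra hcon
  push Not at hcon
  obtain ⟨s, hs⟩ := hS
  -- Let `μ` be the least mean displacement over points of `S` and powers up to `S.card`. Assuming
  -- the claim false gives `τ < μ`, whereas the mean cost of long walks will force `μ ≤ τ`.
  have hne : (S ×ˢ Finset.Icc 1 S.card).Nonempty :=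
    ⟨(s, 1), by simpa [hs] using Finset.card_pos.2 ⟨s, hs⟩⟩
  obtain ⟨⟨p₀, m₀⟩, hpm, hmin⟩ := Finset.exists_min_image _
    (fun pm : ExtVertex Γ × ℕ => ((extGraph Γ).dist pm.1 (act Γ (g ^ pm.2) pm.1) : ℝ) / pm.2) hne
  set μ : ℝ := ((extGraph Γ).dist p₀ (act Γ (g ^ m₀) p₀) : ℝ) / m₀ with hμdef
  simp only [Finset.mem_product, Finset.mem_Icc] at hpm
  have hm₀ : (0 : ℝ) < m₀ := by exact_mod_cast hpm.2.1
  have hτμ : τ < μ := by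
    rw [hμdef, lt_div_iff₀' hm₀]
    exact hcon p₀ m₀ hpm.2.1 hpm.2.2
  have hμ0 : 0 ≤ μ := by positivity
  have hμ : ∀ p ∈ S, ∀ m : ℕ, 1 ≤ m → m ≤ S.card →
      m * μ ≤ (extGraph Γ).dist p (act Γ (g ^ m) p) := by
    intro p hp m hm1 hm2
    have h1 : μ ≤ ((extGraph Γ).dist p (act Γ (g ^ m) p) : ℝ) / m :=
      hmin (p, m) (by simp [hp, hm1, hm2])
    have hm : (0 : ℝ) < m := by exact_mod_cast hm1
    rwa [le_div_iff₀' hm] at h1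
  -- Applying `Transit` repeatedly breaks the distance to `e` translated by `g ^ n` into `n` steps
  -- between points of `S`; the cost of the last piece is discarded.
  have hwalk : ∀ n : ℕ, ∀ s ∈ S, ∃ q : ℕ → ExtVertex Γ, q 0 = s ∧ (∀ i, q i ∈ S) ∧
      ∑ k ∈ Finset.range n, (extGraph Γ).dist (q k) (act Γ g (q (k + 1))) ≤
        (extGraph Γ).dist s (act Γ (g ^ n) e) := by
    intro n
    induction n with
    | zero => exact fun s hs => ⟨fun _ => s, rfl, fun _ => hs, by simp⟩
    | succ n ih =>
      intro s hs
      obtain ⟨s', hs', hd⟩ := hT s hs (n + 1) (by omega)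
      obtain ⟨q, hq0, hqS, hq⟩ := ih s' hs'
      refine ⟨fun k => Nat.casesOn k s q, rfl, ?_, ?_⟩
      · rintro (_ | k)
        exacts [hs, hqS k]
      · rw [Finset.sum_range_succ']
        have h1 : (extGraph Γ).dist (act Γ g s') (act Γ (g ^ (n + 1)) e) =
            (extGraph Γ).dist s' (act Γ (g ^ n) e) := by
          rw [pow_succ, act_mul, dist_act hΓ]
        rw [h1] at hd
        change ∑ k ∈ Finset.range n, (extGraph Γ).dist (q k) (act Γ g (q (k + 1))) +
          (extGraph Γ).dist s (act Γ g (q 0)) ≤ _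
        rw [hq0]
        omega
  set C : ℝ := S.card * μ + (extGraph Γ).dist s e
  have hbound : ∀ n : ℕ, 1 ≤ n →
      μ - C / n ≤ ((extGraph Γ).dist s (act Γ (g ^ n) s) : ℝ) / n := by
    intro n hn
    have hn' : (0 : ℝ) < n := by exact_mod_cast hn
    obtain ⟨q, -, hqS, hq⟩ := hwalk n s hs
    have h1 := mul_le_sum_dist hΓ hμ0 hμ n q hqS
    have h2 := (extGraph_connected hΓ).dist_triangle (u := s) (v := act Γ (g ^ n) s)
      (w := act Γ (g ^ n) e)
    rw [dist_act hΓ] at h2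
    have h3 : ((n : ℝ) - S.card) * μ ≤
        (extGraph Γ).dist s (act Γ (g ^ n) s) + (extGraph Γ).dist s e :=
      h1.trans (by exact_mod_cast hq.trans h2)
    rw [le_div_iff₀ hn', sub_mul, div_mul_cancel₀ _ hn'.ne']
    simp only [C]
    linarith
  have hlim : Tendsto (fun n : ℕ => μ - C / n) atTop (𝓝 (μ - 0)) :=
    tendsto_const_nhds.sub (tendsto_const_div_atTop_nhds_zero_nat _)
  rw [sub_zero] at hlim
  have := le_of_tendsto_of_tendsto hlim (hτ s) (by
    filter_upwards [eventually_ge_atTop 1] with n hn using hbound n hn)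
  linarith

/-- The concatenation of the translates of a geodesic segment from `p` to its image is a geodesic
line, when the powers of the isometry move `p` as far as possible. -/
theorem exists_line (hΓ : Γ.Connected) {f : ArtinGroup Γ} {p : ExtVertex Γ} {k : ℕ} (hk : 0 < k)
    (hp : (extGraph Γ).dist p (act Γ f p) = k)
    (hn : ∀ n : ℕ, n * k ≤ (extGraph Γ).dist p (act Γ (f ^ n) p)) :
    ∃ γ : ℤ → ExtVertex Γ, (∀ i j, (extGraph Γ).dist (γ i) (γ j) = (i - j).natAbs) ∧
      ∀ i, act Γ f (γ i) = γ (i + k) := by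
  have hcn := extGraph_connected hΓ
  obtain ⟨w, hw⟩ := hcn.exists_walk_length_eq_dist p (act Γ f p)
  rw [hp] at hw
  have hk0 : (k : ℤ) ≠ 0 := by omega
  let γ : ℤ → ExtVertex Γ := fun i => act Γ (f ^ (i / k)) (w.getVert (i % k).toNat)
  have hper : ∀ i, act Γ f (γ i) = γ (i + k) := by
    intro i
    simp only [γ]
    rw [Int.add_emod_right, Int.add_ediv_of_dvd_right (dvd_refl _), Int.ediv_self hk0, zpow_add_one,
      act_mul]
  have hstep : ∀ i, (extGraph Γ).dist (γ i) (γ (i + 1)) ≤ 1 := by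
    intro i
    have hm0 := Int.emod_nonneg i hk0
    have hm1 := Int.emod_lt_of_pos i (show (0 : ℤ) < k by omega)
    have hdm := Int.mul_ediv_add_emod i k
    have hadj := w.adj_getVert_succ (i := (i % k).toNat) (by omega)
    have h0 : γ i = act Γ (f ^ (i / k)) (w.getVert (i % k).toNat) := rfl
    suffices h1 : γ (i + 1) = act Γ (f ^ (i / k)) (w.getVert ((i % k).toNat + 1)) by
      rw [h0, h1, dist_act hΓ, SimpleGraph.dist_eq_one_iff_adj.2 hadj]
    change act Γ (f ^ ((i + 1) / k)) (w.getVert ((i + 1) % k).toNat) = _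
    set q := i / k
    set m := i % k
    rcases lt_or_eq_of_le (show m + 1 ≤ k by omega) with hlt | heq
    · have h1 : (i + 1) % k = m + 1 := by
        rw [← hdm, add_assoc, Int.mul_add_emod_self_left]
        exact Int.emod_eq_of_lt (by omega) hlt
      have h2 : (i + 1) / k = q := by
        rw [← hdm, add_assoc, Int.mul_add_ediv_left _ _ hk0, Int.ediv_eq_zero_of_lt (by omega) hlt]
        simp
      rw [h1, h2, show (m + 1).toNat = m.toNat + 1 by omega]
    · have h1 : (i + 1) % k = 0 := by
        rw [← hdm, add_assoc, heq]; simp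
      have h2 : (i + 1) / k = q + 1 := by
        rw [← hdm, add_assoc, heq, Int.mul_add_ediv_left _ _ hk0, Int.ediv_self hk0]
      rw [h1, h2, show m.toNat + 1 = w.length by omega, SimpleGraph.Walk.getVert_length,
        zpow_add, zpow_one, Int.toNat_zero, SimpleGraph.Walk.getVert_zero, ← act_mul]
      congr 1
      rw [← zpow_add_one, ← zpow_one_add, add_comm]
  have hle : ∀ (n : ℕ) i, (extGraph Γ).dist (γ i) (γ (i + n)) ≤ n := by
    intro n i
    induction n with
    | zero => simp
    | succ n ih =>
      have h1 := hcn.dist_triangle (u := γ i) (v := γ (i + n)) (w := γ (i + n + 1))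
      have h2 := hstep (i + n)
      rw [Nat.cast_succ, ← add_assoc]
      omega
  have hmul : ∀ q : ℤ, γ (q * k) = act Γ (f ^ q) p := by
    intro q
    simp only [γ]
    rw [Int.mul_ediv_cancel _ hk0, Int.mul_emod_left, Int.toNat_zero,
      SimpleGraph.Walk.getVert_zero]
  have heq : ∀ (n : ℕ) i, (extGraph Γ).dist (γ i) (γ (i + n)) = n := by
    intro n i
    refine le_antisymm (hle n i) ?_
    -- With this `Q` the segment lies between `-Q * k` and `Q * k`, whose images are at least `2 * Q
    -- * k` apart by `hn`. The upper bounds on the two outer pieces leave at least `n` for the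
    -- segment.
    set Q : ℕ := i.natAbs + n
    have hQ : (Q : ℤ) ≤ Q * k := by
      have : (1 : ℤ) ≤ k := by omega
      nlinarith [Int.natCast_nonneg Q]
    have h1 := hn (2 * Q)
    have h2 : (extGraph Γ).dist (γ (-Q * k)) (γ (Q * k)) =
        (extGraph Γ).dist p (act Γ (f ^ (2 * Q)) p) := by
      rw [hmul, hmul, ← dist_act hΓ (f ^ (-(Q : ℤ))) p, ← act_mul]
      congr 3
      rw [← zpow_natCast, ← zpow_add]
      congr 1
      push_cast
      ring
    rw [← h2] at h1
    have e1 : -(Q : ℤ) * k = -(Q * k) := by ring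
    have h3 := hle (i + Q * k).toNat (-Q * k)
    have h4 := hle (Q * k - (i + n)).toNat (i + n)
    rw [show -(Q : ℤ) * k + ((i + Q * k).toNat : ℤ) = i by omega] at h3
    rw [show i + n + (((Q : ℤ) * k - (i + n)).toNat : ℤ) = Q * k by omega] at h4
    have h5 := hcn.dist_triangle (u := γ (-Q * k)) (v := γ i) (w := γ (Q * k))
    have h6 := hcn.dist_triangle (u := γ i) (v := γ (i + n)) (w := γ (Q * k))
    have e2 : (((2 * Q * k : ℕ)) : ℤ) = 2 * (Q * k) := by push_cast; ring
    omega
  refine ⟨γ, fun i j => ?_, hper⟩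
  rcases le_total i j with h | h
  · have := heq (j - i).toNat i
    rw [show i + ((j - i).toNat : ℤ) = j by omega] at this
    omega
  · have := heq (i - j).toNat j
    rw [show j + ((i - j).toNat : ℤ) = i by omega] at this
    rw [SimpleGraph.dist_comm]
    omega

/-- The lines are the translates of a line shifted by `g ^ m`. If two of them met, some point would
be moved by `g ^ r`, with `1 ≤ r < m`, by exactly `r * τ`, against the minimality of `m`. -/
theorem cyclicallyPermutes_of_dist_eq (hΓ : Γ.Connected) {g : ArtinGroup Γ} {τ : ℝ} (hτ0 : 0 < τ)
    (hτ : IsTranslationLength Γ g τ) {p : ExtVertex Γ} {m : ℕ} (hm : 1 ≤ m)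
    (hp : ((extGraph Γ).dist p (act Γ (g ^ m) p) : ℝ) = m * τ)
    (hmin : ∀ j : ℕ, 1 ≤ j → j < m → ∀ x,
      j * τ < ((extGraph Γ).dist x (act Γ (g ^ j) x) : ℝ)) :
    CyclicallyPermutes (extGraph Γ) (act Γ g) m := by
  set k := (extGraph Γ).dist p (act Γ (g ^ m) p) with hk
  have hm' : (0 : ℝ) < m := by exact_mod_cast hm
  have hk0 : 0 < k := by
    have : (0 : ℝ) < k := by rw [hp]; positivity
    exact_mod_cast this
  obtain ⟨γ, hγ, hper⟩ := exists_line hΓ hk0 hk.symm (fun n => by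
    have h1 := mul_translationLength_le hΓ hτ p (m * n)
    rw [pow_mul] at h1
    have h2 : ((n * k : ℕ) : ℝ) ≤ (extGraph Γ).dist p (act Γ ((g ^ m) ^ n) p) := by
      push_cast at h1 ⊢
      rw [hp]
      linarith
    exact_mod_cast h2)
  have hpern : ∀ (n : ℕ) i, act Γ (g ^ (m * n)) (γ i) = γ (i + n * k) := by
    intro n i
    rw [pow_mul]
    induction n with
    | zero => simp [act_one]
    | succ n ih =>
      rw [pow_succ, act_mul, ih, hper]
      congr 1
      push_cast
      ring
  set R := Set.range γ with hR
  have himage : ∀ a b (X : Set (ExtVertex Γ)), act Γ b '' (act Γ a '' X) = act Γ (a * b) '' X := by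
    intro a b X
    rw [Set.image_image]
    exact Set.image_congr fun x _ => (act_mul Γ a b x).symm
  have hRn : ∀ n : ℕ, act Γ (g ^ (m * n)) '' R = R := by
    intro n
    rw [hR, ← Set.range_comp]
    have : (act Γ (g ^ (m * n)) : ExtVertex Γ → ExtVertex Γ) ∘ γ = γ ∘ (Equiv.addRight ((n : ℤ) * k)) := by
      funext i
      exact hpern n i
    rw [this, EquivLike.range_comp]
  have hmod : ∀ n : ℕ, act Γ (g ^ n) '' R = act Γ (g ^ (n % m)) '' R := by
    intro n
    conv_lhs => rw [← Nat.div_add_mod n m, pow_add, ← himage, hRn]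
  have hdisj : ∀ i r : ℕ, 1 ≤ r → r < m → Disjoint (act Γ (g ^ i) '' R) (act Γ (g ^ (i + r)) '' R) := by
    intro i r hr hrm
    rw [Set.disjoint_left]
    rintro _ ⟨_, ⟨s, rfl⟩, rfl⟩ ⟨_, ⟨t, rfl⟩, he⟩
    rw [add_comm i r, pow_add, act_mul] at he
    have he := (act Γ (g ^ i)).injective he
    set D := s - t with hD
    -- Here `g ^ r` sends `γ t` to `γ s`. The displacements by `g ^ (r + m * n)` and `g ^ (m * n -
    -- r)` are `n * k + D` and `n * k - D`; bounding both below by the translation length, with `k =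
    -- m * τ`, gives `D = r * τ`. This `n` is large enough for the signs and the subtraction.
    set n : ℕ := D.natAbs + 1
    have hnk : (n : ℤ) ≤ n * k := by
      have : (1 : ℤ) ≤ k := by omega
      nlinarith [Int.natCast_nonneg n]
    have hrn : r ≤ m * n := by
      have : m * 1 ≤ m * n := Nat.mul_le_mul_left m (by omega)
      omega
    have h1 := mul_translationLength_le hΓ hτ (γ t) (r + m * n)
    rw [pow_add, act_mul, he, hpern, hγ] at h1
    have h2 := mul_translationLength_le hΓ hτ (γ s) (m * n - r)
    have h3 : act Γ (g ^ (m * n - r)) (γ s) = γ (t + n * k) := by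
      rw [← he, ← act_mul, ← pow_add, Nat.add_sub_cancel' hrn, hpern]
    rw [h3, hγ] at h2
    have e1 : (((t - (s + n * k)).natAbs : ℕ) : ℝ) = D + n * k := by
      have : (((t - (s + n * k)).natAbs : ℕ) : ℤ) = D + n * k := by omega
      rw [← Int.cast_natCast (R := ℝ), this]
      push_cast
      ring
    have e2 : (((s - (t + n * k)).natAbs : ℕ) : ℝ) = n * k - D := by
      have : (((s - (t + n * k)).natAbs : ℕ) : ℤ) = n * k - D := by omega
      rw [← Int.cast_natCast (R := ℝ), this]
      push_cast
      ring
    rw [e1] at h1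
    rw [e2] at h2
    rw [Nat.cast_sub hrn] at h2
    push_cast at h1 h2
    have h4 : (D : ℝ) = r * τ := by
      rw [hp] at h1 h2
      nlinarith
    have h5 := hmin r hr hrm (γ t)
    rw [he, hγ] at h5
    have hD0 : 0 ≤ D := by
      have : (0 : ℝ) ≤ D := by rw [h4]; positivity
      exact_mod_cast this
    have e3 : (((t - s).natAbs : ℕ) : ℝ) = D := by
      have : (((t - s).natAbs : ℕ) : ℤ) = D := by omega
      rw [← Int.cast_natCast (R := ℝ), this]
    rw [e3, h4] at h5
    exact lt_irrefl _ h5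
  have : NeZero m := ⟨by omega⟩
  refine ⟨fun i => act Γ (g ^ i.val) '' R, fun i => ?_, fun i j hij => ?_, fun i => ?_⟩
  · refine ⟨fun t => act Γ (g ^ i.val) (γ t), fun s t => ?_, ?_⟩
    · rw [dist_act hΓ, hγ]
    · exact (Set.range_comp (act Γ (g ^ i.val)) γ).symm
  · have hv : i.val ≠ j.val := fun h => hij (ZMod.val_injective m h)
    have hi := ZMod.val_lt i
    have hj := ZMod.val_lt j
    rcases lt_or_gt_of_ne hv with h | h
    · have := hdisj i.val (j.val - i.val) (by omega) (by omega)
      rwa [Nat.add_sub_cancel' h.le] at this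
    · have := hdisj j.val (i.val - j.val) (by omega) (by omega)
      rw [Nat.add_sub_cancel' h.le] at this
      exact this.symm
  · have h1 : (i + 1).val = (i.val + 1) % m := by
      rw [← ZMod.val_natCast, Nat.cast_succ, ZMod.natCast_zmod_val]
    change act Γ g '' (act Γ (g ^ i.val) '' R) = act Γ (g ^ (i + 1).val) '' R
    rw [himage, ← pow_succ, hmod, h1]

/-- Otherwise `v` would be central and `g` would fix a vertex of `Γ^e`. -/
theorem exists_not_mem_star (hΓ : Γ.Connected) {g : ArtinGroup Γ} {τ : ℝ} (hτ0 : 0 < τ)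
    (hτ : IsTranslationLength Γ g τ) (v : V) : ∃ u, u ∉ star Γ v := by
  by_contra hcon
  push Not at hcon
  have h1 := mul_translationLength_le hΓ hτ (ev v 1) 1
  have h2 : act Γ (g ^ 1) (ev v 1) = ev v 1 := by
    rw [pow_one, act_ev, one_mul]
    have := ev_mul (Γ := Γ) (u := v) (c := g) (k := 1) (by
      rw [Set.eq_univ_of_forall hcon, parabolic_univ]; trivial)
    rwa [mul_one] at this
  rw [h2, SimpleGraph.dist_self] at h1
  norm_num at h1
  linarith

/-- With all degrees at most one, connectedness would leave only `v` and `b`. The bound is needed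
for the two-point set of the adjacent case. -/
theorem two_le_maxDegree [Fintype V] [DecidableRel Γ.Adj] (hΓ : Γ.Connected) {v b u : V}
    (hvb : Γ.Adj v b) (hu : u ∉ star Γ v) : 2 ≤ Γ.maxDegree := by
  by_contra hlt
  have huniq : ∀ x y z, Γ.Adj x y → Γ.Adj x z → y = z := by
    intro x y z hy hz
    have h1 : (Γ.neighborFinset x).card ≤ 1 := by
      rw [SimpleGraph.card_neighborFinset_eq_degree]
      have := Γ.degree_le_maxDegree x
      omega
    exact Finset.card_le_one.1 h1 y (by simpa using hy) z (by simpa using hz)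
  have hclosed : ∀ x y, Γ.Reachable x y → (x = v ∨ x = b) → (y = v ∨ y = b) := by
    rintro x y ⟨w⟩
    induction w with
    | nil => exact id
    | cons h w ih =>
      rintro (rfl | rfl)
      · exact ih (Or.inr (huniq _ _ _ h hvb))
      · exact ih (Or.inl (huniq _ _ _ h hvb.symm))
  rcases hclosed v u (hΓ.preconnected v u) (Or.inl rfl) with rfl | rfl
  · exact hu (Or.inl rfl)
  · exact hu (Or.inr hvb)

theorem exists_dist_le_mul [Fintype V] [DecidableRel Γ.Adj] (hΓ : Γ.Connected)
    (hgirth : 6 ≤ Γ.egirth) {g : ArtinGroup Γ} {τ : ℝ} (hτ0 : 0 < τ)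
    (hτ : IsTranslationLength Γ g τ) :
    ∃ m : ℕ, 1 ≤ m ∧ m ≤ Γ.maxDegree ∧
      ∃ p, ((extGraph Γ).dist p (act Γ (g ^ m) p) : ℝ) ≤ m * τ := by
  classical
  have hg : g ≠ 1 := by
    rintro rfl
    obtain ⟨v⟩ := hΓ.nonempty
    have h1 := mul_translationLength_le hΓ hτ (ev v 1) 1
    rw [one_pow, act_one, SimpleGraph.dist_self] at h1
    norm_num at h1
    linarith
  suffices h : ∃ (S : Finset (ExtVertex Γ)) (e : ExtVertex Γ), S.Nonempty ∧
      S.card ≤ Γ.maxDegree ∧ Transit Γ g S e by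
    obtain ⟨S, e, hS, hc, hT⟩ := h
    obtain ⟨p, m, h1, h2, h3⟩ := hT.exists_dist_le hΓ hτ hS
    exact ⟨m, h1, h2.trans hc, p, h3⟩
  obtain ⟨a⟩ := exists_axis hg
  by_cases ha : ∃ i, Γ.Adj (a.c i).1 (a.c (i + 1)).1
  · obtain ⟨i, hi⟩ := ha
    obtain ⟨u, hu⟩ := exists_not_mem_star hΓ hτ0 hτ (a.c i).1
    refine ⟨{ev (a.c i).1 (a.h i), ev (a.c (i + 1)).1 (a.h i)},
      ev (a.c i).1 (a.h (i + 2)), by simp,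
      Finset.card_le_two.trans (two_le_maxDegree hΓ hi hu), ?_⟩
    have := a.transit_of_adj hΓ hgirth hi
    simpa using this
  · push Not at ha
    obtain ⟨u, hu⟩ := exists_not_mem_star hΓ hτ0 hτ (a.c 0).1
    obtain ⟨b, hb⟩ : ∃ b, Γ.Adj (a.c 0).1 b := by
      obtain ⟨w⟩ := hΓ.preconnected (a.c 0).1 u
      cases w with
      | nil => exact absurd (Or.inl rfl) hu
      | cons h _ => exact ⟨_, h⟩
    refine ⟨(Γ.neighborFinset (a.c 0).1).image fun w => ev w (a.h 0), ev b (a.h (0 + 1)),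
      ⟨_, Finset.mem_image_of_mem _ ((Γ.mem_neighborFinset _ _).2 hb)⟩,
      Finset.card_image_le.trans ?_, ?_⟩
    · rw [SimpleGraph.card_neighborFinset_eq_degree]
      exact Γ.degree_le_maxDegree _
    · have := a.transit_of_not_adj hΓ ha 0 hb
      simpa using this

end Periodic

end RAAG

theorem mainTheorem5 {V : Type*} [Fintype V] (Γ : SimpleGraph V) [DecidableRel Γ.Adj]
    (hconn : Γ.Connected) (hgirth : 6 ≤ Γ.egirth)
    (g : RAAG.ArtinGroup Γ) (hg : RAAG.IsLoxodromic Γ g) :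
    (∃ m : ℕ, 1 ≤ m ∧ m ≤ Γ.maxDegree ∧
      RAAG.CyclicallyPermutes (RAAG.extGraph Γ) (RAAG.act Γ g) m) ∧
    ∃ q : ℚ, q.den ≤ Γ.maxDegree ∧ RAAG.IsTranslationLength Γ g (q : ℝ) := by
  classical
  obtain ⟨τ, hτ0, hτ⟩ := hg
  have hex : ∃ m : ℕ, 1 ≤ m ∧ m ≤ Γ.maxDegree ∧
      ∃ p, ((RAAG.extGraph Γ).dist p (RAAG.act Γ (g ^ m) p) : ℝ) ≤ m * τ :=
    RAAG.exists_dist_le_mul hconn hgirth hτ0 hτ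
  obtain ⟨hm1, hmN, p, hp⟩ := Nat.find_spec hex
  -- The least such `m` makes the lines disjoint; the reverse inequality gives `τ` as an integer
  -- divided by `m`.
  set m := Nat.find hex with hm
  have hp' := le_antisymm hp (RAAG.mul_translationLength_le hconn hτ p m)
  refine ⟨⟨m, hm1, hmN, RAAG.cyclicallyPermutes_of_dist_eq hconn hτ0 hτ hm1 hp' ?_⟩, ?_⟩
  · intro j hj1 hjm x
    by_contra hle
    exact Nat.find_min hex hjm ⟨hj1, by omega, x, not_lt.1 hle⟩
  · have hm' : (0 : ℝ) < m := by exact_mod_cast hm1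
    refine ⟨((RAAG.extGraph Γ).dist p (RAAG.act Γ (g ^ m) p) : ℚ) / m, ?_, ?_⟩
    · refine le_trans (Nat.le_of_dvd hm1 ?_) hmN
      have h1 := Rat.den_dvd ((RAAG.extGraph Γ).dist p (RAAG.act Γ (g ^ m) p)) m
      rw [Rat.divInt_eq_div, Int.cast_natCast, Int.cast_natCast] at h1
      exact Int.natCast_dvd_natCast.1 h1
    · push_cast
      rw [hp', mul_div_cancel_left₀ _ hm'.ne']
      exact hτ
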